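/- Let $m\ge 0$, let $\Omega_1=(0,\infty)^m$ and let $\Omega_2$ be a convex subset of a real vector space $A$ with a partial order $\le_A$. Put $\Omega=\Omega_1\times\Omega_2\subset\mathbb{R}^m\times A$, and order $\mathbb{R}^m\times A$ by $(\mathbf{x},z)\le(\mathbf{x}',z')$ if and only if $x_i\le x_i'$ for all $i$ and $z\le_A z'$. A real function on $\Omega$ is called CM if it is convex, and monotone (nondecreasing) with respect to this order. Let $t_n<t_{n+1}$ be real numbers, and let $a_{i,j},b_i,c$ ($1\le i,j\le m$) be continuous real functions of $t\in[t_n,t_{n+1}]$ only, with $(a_{i,j})$ uniformly elliptic: there is $\lambda>0$ with $\sum_{i,j}a_{i,j}(t)\xi_i\xi_j\ge\lambda|\xi|^2$ for all $\xi\in\mathbb{R}^m$ and $t\in[t_n,t_{n+1}]$. Let $$\mathcal{L}=\frac12\sum_{i,j=1}^m a_{i,j}x_ix_j\,\partial_{x_i}\partial_{x_j}+\sum_{i=1}^m b_ix_i\,\partial_{x_i}+c .$$ Let $\omega=\omega(\mathbf{x},z,t)$ be such that, for each $z\in\Omega_2$, $(\mathbf{x},t)\mapsto\omega(\mathbf{x},z,t)$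 is continuous on $\Omega_1\times[t_n,t_{n+1}]$, and let $\varphi:\Omega\to\mathbb{R}$. Suppose that $V=V(\mathbf{x},z,t)$ is a classical solution of $$\partial_tV+\mathcal{L}V+\omega=0\ \text{ on }\Omega\times(t_n,t_{n+1}),\qquad V(\mathbf{x},z,t_{n+1}^-)=\varphi(\mathbf{x},z)\ \text{ on }\Omega,$$ that is, for each $z\in\Omega_2$ the function $(\mathbf{x},t)\mapsto V(\mathbf{x},z,t)$ is of class $C^{2,1}$ on $\Omega_1\times(t_n,t_{n+1})$ and continuous on $\Omega_1\times(t_n,t_{n+1}]$, and the two equations hold pointwise. Suppose also that $V$ satisfies the following growth condition: for each $z\in\Omega_2$ there is $k>0$ such that $u(\mathbf{y},z,\tau)=V(e^{y_1},\dots,e^{y_m},z,t_{n+1}-\tau)$ satisfies $$\int_0^{t_{n+1}-t_n}\int_{\mathbb{R}^m}|u(\mathbf{y},z,\tau)|\,e^{-k|\mathbf{y}|^2}\,d\mathbf{y}\,d\tau<\infty .$$ If $\varphi$ is CM and $\omega(\cdot,t)$ is CM for every $t\in(t_n,t_{n+1}]$, then $V(\cdot,t)$ is CM on $\Omega$ for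 every $t\in(t_n,t_{n+1}]$. In particular, the limit $V_n^+(\mathbf{x},z)=\lim_{t\downarrow t_n}V(\mathbf{x},z,t)$ exists for every $(\mathbf{x},z)\in\Omega$, and $V_n^+$ is CM on $\Omega$. -/

import Mathlib

open Set Filter Topology MeasureTheory

/-- The open positive orthant `(0, ∞)^m`. -/
def posOrthant (m : ℕ) : Set (Fin m → ℝ) := {x | ∀ i, 0 < x i}

/-- The partial derivative `∂f/∂x_i` at `x`. -/
noncomputable def partialDeriv {m : ℕ} (i : Fin m) (f : (Fin m → ℝ) → ℝ) (x : Fin m → ℝ) : ℝ :=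
  lineDeriv ℝ f x (Pi.single i 1)

/-- `f(x, t)` is of class `C^{2,1}` on `U × I` (`U`, `I` open): the partial derivatives
`∂_t f`, `∂_{x_i} f` and `∂_{x_i} ∂_{x_j} f` exist at every point of `U × I`, and they and `f`
are jointly continuous on `U × I`. -/
structure IsC21On {m : ℕ} (f : (Fin m → ℝ) → ℝ → ℝ) (U : Set (Fin m → ℝ)) (I : Set ℝ) :
    Prop where
  differentiable_t : ∀ x ∈ U, ∀ t ∈ I, DifferentiableAt ℝ (fun s => f x s) t
  differentiable_x : ∀ x ∈ U, ∀ t ∈ I, ∀ i : Fin m,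
    LineDifferentiableAt ℝ (fun y => f y t) x (Pi.single i 1)
  differentiable_xx : ∀ x ∈ U, ∀ t ∈ I, ∀ i j : Fin m,
    LineDifferentiableAt ℝ (fun y => partialDeriv j (fun w => f w t) y) x (Pi.single i 1)
  continuous_zero : ContinuousOn (fun p : (Fin m → ℝ) × ℝ => f p.1 p.2) (U ×ˢ I)
  continuous_t : ContinuousOn
    (fun p : (Fin m → ℝ) × ℝ => deriv (fun s => f p.1 s) p.2) (U ×ˢ I)
  continuous_x : ∀ i : Fin m, ContinuousOn
    (fun p : (Fin m → ℝ) × ℝ => partialDeriv i (fun w => f w p.2) p.1) (U ×ˢ I)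
  continuous_xx : ∀ i j : Fin m, ContinuousOn
    (fun p : (Fin m → ℝ) × ℝ =>
      partialDeriv i (fun y => partialDeriv j (fun w => f w p.2) y) p.1) (U ×ˢ I)

/-- The operator
`𝓛 = (1/2) ∑_{i,j} a_{ij}(t) x_i x_j ∂_{x_i} ∂_{x_j} + ∑_i b_i(t) x_i ∂_{x_i} + c(t)`
at time `t`, applied to `f` at the point `x`. -/
noncomputable def gbmOperator {m : ℕ} (a : Fin m → Fin m → ℝ → ℝ) (b : Fin m → ℝ → ℝ)
    (c : ℝ → ℝ) (t : ℝ) (f : (Fin m → ℝ) → ℝ) (x : Fin m → ℝ) : ℝ :=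
  (1 / 2 : ℝ) * ∑ i, ∑ j, a i j t * x i * x j * partialDeriv i (fun y => partialDeriv j f y) x
    + ∑ i, b i t * x i * partialDeriv i f x + c t * f x

/-- `V` solves the terminal value problem `∂_t V + 𝓛 V + ω = 0` on
`(0, ∞)^m × Ω₂ × (t₀, t₁)`, `V(·, t₁⁻) = φ`, in the classical sense. The last state variable
`z ∈ Ω₂` enters the equation only as a parameter. -/
structure IsClassicalSolution {m : ℕ} {A : Type*} (Ω₂ : Set A) (t₀ t₁ : ℝ)
    (a : Fin m → Fin m → ℝ → ℝ) (b : Fin m → ℝ → ℝ) (c : ℝ → ℝ)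
    (ω : (Fin m → ℝ) × A → ℝ → ℝ) (φ : (Fin m → ℝ) × A → ℝ)
    (V : (Fin m → ℝ) × A → ℝ → ℝ) : Prop where
  regular : ∀ z ∈ Ω₂, IsC21On (fun x t => V (x, z) t) (posOrthant m) (Ioo t₀ t₁)
  continuous : ∀ z ∈ Ω₂, ContinuousOn (fun p : (Fin m → ℝ) × ℝ => V (p.1, z) p.2)
    (posOrthant m ×ˢ Ioc t₀ t₁)
  equation : ∀ x ∈ posOrthant m, ∀ z ∈ Ω₂, ∀ t ∈ Ioo t₀ t₁,
    deriv (fun s => V (x, z) s) t + gbmOperator a b c t (fun y => V (y, z) t) x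
      + ω (x, z) t = 0
  terminal : ∀ x ∈ posOrthant m, ∀ z ∈ Ω₂,
    Tendsto (fun t => V (x, z) t) (𝓝[<] t₁) (𝓝 (φ (x, z)))

/-- Uniform ellipticity, on the time interval `I`, of the matrix `a(t)`. -/
def IsUniformlyElliptic {m : ℕ} (a : Fin m → Fin m → ℝ → ℝ) (I : Set ℝ) : Prop :=
  ∃ lam : ℝ, 0 < lam ∧ ∀ t ∈ I, ∀ ξ : Fin m → ℝ,
    lam * ∑ i, ξ i ^ 2 ≤ ∑ i, ∑ j, a i j t * ξ i * ξ j

/-- The function `u(y, z, τ) = V(e^y, z, t₁ - τ)` in logarithmic coordinates and in time to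
the terminal date. -/
noncomputable def logTransform {m : ℕ} {A : Type*} (t₁ : ℝ) (V : (Fin m → ℝ) × A → ℝ → ℝ)
    (y : Fin m → ℝ) (z : A) (τ : ℝ) : ℝ :=
  V (fun i => Real.exp (y i), z) (t₁ - τ)

/-- The growth condition on `u` (the uniqueness class of the Cauchy problem): for each `z`, there
is `k > 0` with `∫_0^{t₁ - t₀} ∫_{ℝ^m} |u(y, z, τ)| exp(-k |y|²) dy dτ < ∞`. -/
def GaussianGrowth {m : ℕ} {A : Type*} (Ω₂ : Set A) (t₀ t₁ : ℝ)
    (V : (Fin m → ℝ) × A → ℝ → ℝ) : Prop :=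
  ∀ z ∈ Ω₂, ∃ k : ℝ, 0 < k ∧
    IntegrableOn (fun p : (Fin m → ℝ) × ℝ =>
        logTransform t₁ V p.1 z p.2 * Real.exp (-k * ∑ i, p.1 i ^ 2))
      (univ ×ˢ Ioo 0 (t₁ - t₀)) volume

/-! In logarithmic coordinates `x = exp y` and reversed time, the equation becomes parabolic with
coefficients depending on time alone, so translates in `y` and linear combinations of solutions,
even for different parameters `z`, solve equations with the same operator. Translating by `logVec x`
replaces `exp y` by `x` scaled coordinatewise by `exp y`, and such a scaling commutes with convex
combinations and preserves the order.

For convexity, fix two points and weights, and let `W(y, τ)` be the weighted sum of the solutions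
translated to the two points minus the solution translated to their convex combination. Convexity of
`φ` and `ω` makes the initial value and the source of `W` nonnegative for every `y`; a minimum
principle gives `W ≥ 0`, and `y = 0` is the convexity inequality. Monotonicity uses a difference of
two translates (`IsClassicalSolution.convexOn`, `IsClassicalSolution.monotoneOn`).

The minimum principle is `IsWeakSol.nonneg`. Growth is controlled only in an integral sense, so the
solution is first mollified in space. Mollification commutes with the operator, and integrating its
time derivative gives a pointwise Gaussian lower bound (`IsWeakSol.exists_mollify_ge`). Tychonoff's
barrier argument then applies on short time steps of fixed length (`exists_short_time_nonneg`), and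
a bump function localised where the solution is negative gives the contradiction.

For the limit at `t₀`, mollifications converge because their time derivatives are integrable up to
the end. By monotonicity they squeeze `V` between its values on the ray through `x`, and convexity
along that ray makes the gap small (`exists_tendsto_of_convexOn_of_squeeze`). Convexity and
monotonicity pass to pointwise limits. -/

/-! ### Directional derivatives and second-order conditions at a minimum -/

/-- The derivative of `f` in the direction `v`, as a function of the point. -/
noncomputable def dirDeriv {m : ℕ} (v : Fin m → ℝ) (f : (Fin m → ℝ) → ℝ) (y : Fin m → ℝ) : ℝ :=
  fderiv ℝ f y v

/-- The `i`-th coordinate vector. -/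
abbrev coordVec {m : ℕ} (i : Fin m) : Fin m → ℝ := Pi.single i 1

theorem ContDiff.dirDeriv {m : ℕ} {f : (Fin m → ℝ) → ℝ} {n k : WithTop ℕ∞} (hf : ContDiff ℝ n f)
    (hk : k + 1 ≤ n) (v : Fin m → ℝ) : ContDiff ℝ k (dirDeriv v f) :=
  (hf.fderiv_right hk).clm_apply contDiff_const

theorem dirDeriv_eq_sum {m : ℕ} (v : Fin m → ℝ) (f : (Fin m → ℝ) → ℝ) (y : Fin m → ℝ) :
    dirDeriv v f y = ∑ i, v i * dirDeriv (coordVec i) f y := by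
  have h : v = ∑ i, v i • (coordVec i : Fin m → ℝ) := by
    ext j; simp [Finset.sum_apply, Pi.single_apply]
  unfold dirDeriv
  conv_lhs => rw [h]
  simp [map_sum]

theorem hasDerivAt_comp_line {m : ℕ} {f : (Fin m → ℝ) → ℝ} (hf : Differentiable ℝ f)
    (y v : Fin m → ℝ) (s : ℝ) :
    HasDerivAt (fun s : ℝ => f (y + s • v)) (dirDeriv v f (y + s • v)) s := by
  have h1 : HasDerivAt (fun s : ℝ => y + s • v) v s := by
    simpa using ((hasDerivAt_id s).smul_const v).const_add y
  exact (hf _).hasFDerivAt.comp_hasDerivAt s h1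

/-- The second derivative is nonnegative at a local minimum. -/
theorem IsLocalMin.deriv_deriv_nonneg {h : ℝ → ℝ} {x : ℝ} (hmin : IsLocalMin h x)
    (hc : ContinuousAt h x) : 0 ≤ deriv (deriv h) x := by
  by_contra! hneg
  -- A negative second derivative would make the point a local maximum as well, so `h` would be
  -- locally constant.
  have hmax := isLocalMax_of_deriv_deriv_neg hneg hmin.deriv_eq_zero hc
  have heq : h =ᶠ[𝓝 x] fun _ => h x := by
    filter_upwards [hmin, hmax] with y h1 h2 using le_antisymm h2 h1
  have : deriv (deriv h) x = 0 := by
    rw [heq.deriv.deriv_eq]; simp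
  linarith

/-- Decompose `H` as a sum of rank-one matrices `w wᵀ`; the pairing becomes a sum of values of the
quadratic form of `a`. No symmetry of `a` is needed. -/
theorem sum_mul_nonneg_of_posSemidef {m : ℕ} {a H : Fin m → Fin m → ℝ}
    (ha : ∀ ξ : Fin m → ℝ, 0 ≤ ∑ i, ∑ j, a i j * ξ i * ξ j)
    (hsymm : ∀ i j, H i j = H j i) (hH : ∀ ξ : Fin m → ℝ, 0 ≤ ∑ i, ∑ j, ξ i * ξ j * H i j) :
    0 ≤ ∑ i, ∑ j, a i j * H i j := by
  have hps : (Matrix.of H).PosSemidef := by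
    refine Matrix.PosSemidef.of_dotProduct_mulVec_nonneg ?_ fun ξ => ?_
    · ext i j; simp [hsymm j i]
    · refine (hH ξ).trans_eq ?_
      simp only [dotProduct, Matrix.mulVec, Finset.mul_sum, star_trivial, Matrix.of_apply]
      exact Finset.sum_congr rfl fun i _ => Finset.sum_congr rfl fun j _ => by ring
  obtain ⟨n, w, hw⟩ := Matrix.posSemidef_iff_eq_sum_vecMulVec.1 hps
  have hij : ∀ i j, H i j = ∑ k, w k i * w k j := by
    intro i j
    have := congrFun (congrFun hw i) j
    simpa [Matrix.sum_apply, Matrix.vecMulVec_apply] using this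
  have : ∑ i, ∑ j, a i j * H i j = ∑ k, ∑ i, ∑ j, a i j * w k i * w k j := by
    rw [Finset.sum_comm]
    simp only [hij, Finset.mul_sum]
    rw [Finset.sum_comm, Finset.sum_congr rfl fun i _ => Finset.sum_comm, Finset.sum_comm]
    refine Finset.sum_congr rfl fun k _ => Finset.sum_congr rfl fun i _ =>
      Finset.sum_congr rfl fun j _ => by ring
  rw [this]
  exact Finset.sum_nonneg fun k _ => ha (w k)

theorem dirDeriv_eq_zero_of_isLocalMin {m : ℕ} {f : (Fin m → ℝ) → ℝ} {y : Fin m → ℝ}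
    (hmin : IsLocalMin f y) (v : Fin m → ℝ) : dirDeriv v f y = 0 := by
  simp [dirDeriv, hmin.fderiv_eq_zero]

theorem dirDeriv_dirDeriv {m : ℕ} {f : (Fin m → ℝ) → ℝ} (hf : ContDiff ℝ 2 f)
    (v w : Fin m → ℝ) (y : Fin m → ℝ) :
    dirDeriv v (dirDeriv w f) y = fderiv ℝ (fderiv ℝ f) y v w := by
  have h : DifferentiableAt ℝ (fderiv ℝ f) y :=
    ((hf.fderiv_right (m := 1) (by norm_num)).differentiable one_ne_zero) y
  unfold dirDeriv
  rw [fderiv_clm_apply h (differentiableAt_const w)]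
  simp

theorem dirDeriv_comm {m : ℕ} {f : (Fin m → ℝ) → ℝ} (hf : ContDiff ℝ 2 f)
    (v w : Fin m → ℝ) (y : Fin m → ℝ) :
    dirDeriv v (dirDeriv w f) y = dirDeriv w (dirDeriv v f) y := by
  rw [dirDeriv_dirDeriv hf, dirDeriv_dirDeriv hf]
  exact hf.contDiffAt.isSymmSndFDerivAt (by simp) v w

/-- Restricting `f` to lines through `y` shows that its Hessian is positive semidefinite there, and
`sum_mul_nonneg_of_posSemidef` pairs it with `a`. -/
theorem trace_hessian_nonneg_of_isLocalMin {m : ℕ} {f : (Fin m → ℝ) → ℝ} (hf : ContDiff ℝ 2 f)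
    {y : Fin m → ℝ} (hmin : IsLocalMin f y) {a : Fin m → Fin m → ℝ}
    (ha : ∀ ξ : Fin m → ℝ, 0 ≤ ∑ i, ∑ j, a i j * ξ i * ξ j) :
    0 ≤ ∑ i, ∑ j, a i j * dirDeriv (coordVec i) (dirDeriv (coordVec j) f) y := by
  refine sum_mul_nonneg_of_posSemidef ha (fun i j => dirDeriv_comm hf _ _ _) fun ξ => ?_
  have hd : Differentiable ℝ f := hf.differentiable two_ne_zero
  have hd2 : Differentiable ℝ (dirDeriv ξ f) :=
    (hf.dirDeriv (k := 1) (by norm_num) ξ).differentiable one_ne_zero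
  have hline : Tendsto (fun s : ℝ => y + s • ξ) (𝓝 0) (𝓝 y) := by
    have : Continuous fun s : ℝ => y + s • ξ := by fun_prop
    simpa using this.tendsto 0
  have hmin' : IsLocalMin (fun s : ℝ => f (y + s • ξ)) 0 := by
    have := hline.eventually hmin
    unfold IsLocalMin IsMinFilter
    simpa using this
  have h := hmin'.deriv_deriv_nonneg (hasDerivAt_comp_line hd y ξ 0).continuousAt
  have e1 : deriv (fun s : ℝ => f (y + s • ξ)) = fun s : ℝ => dirDeriv ξ f (y + s • ξ) :=
    funext fun s => (hasDerivAt_comp_line hd y ξ s).deriv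
  rw [e1, (hasDerivAt_comp_line hd2 y ξ 0).deriv] at h
  simp only [zero_smul, add_zero] at h
  refine h.trans_eq ?_
  rw [dirDeriv_comm hf, dirDeriv_eq_sum]
  refine Finset.sum_congr rfl fun i _ => ?_
  rw [dirDeriv_comm hf, dirDeriv_eq_sum, Finset.mul_sum]
  refine Finset.sum_congr rfl fun j _ => ?_
  rw [dirDeriv_comm hf]; ring

/-! ### The spatial operator at a fixed time -/

/-- The operator `½ ∑ a_{ij} ∂_i ∂_j + ∑ β_i ∂_i + γ` with constant coefficients. -/
noncomputable def ellOp {m : ℕ} (a : Fin m → Fin m → ℝ) (β : Fin m → ℝ) (γ : ℝ)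
    (f : (Fin m → ℝ) → ℝ) (y : Fin m → ℝ) : ℝ :=
  (1 / 2 : ℝ) * ∑ i, ∑ j, a i j * dirDeriv (coordVec i) (dirDeriv (coordVec j) f) y
    + ∑ i, β i * dirDeriv (coordVec i) f y + γ * f y

theorem dirDeriv_add {m : ℕ} {f g : (Fin m → ℝ) → ℝ} (hf : Differentiable ℝ f)
    (hg : Differentiable ℝ g) (v : Fin m → ℝ) :
    dirDeriv v (fun y => f y + g y) = fun y => dirDeriv v f y + dirDeriv v g y := by
  ext y; simp [dirDeriv, fderiv_fun_add (hf y) (hg y)]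

theorem dirDeriv_const_mul {m : ℕ} {f : (Fin m → ℝ) → ℝ} (hf : Differentiable ℝ f)
    (c : ℝ) (v : Fin m → ℝ) :
    dirDeriv v (fun y => c * f y) = fun y => c * dirDeriv v f y := by
  ext y; simp [dirDeriv, fderiv_const_mul (hf y)]

theorem ellOp_add {m : ℕ} (a : Fin m → Fin m → ℝ) (β : Fin m → ℝ) (γ : ℝ)
    {f g : (Fin m → ℝ) → ℝ} (hf : ContDiff ℝ 2 f) (hg : ContDiff ℝ 2 g) (y : Fin m → ℝ) :
    ellOp a β γ (fun y => f y + g y) y = ellOp a β γ f y + ellOp a β γ g y := by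
  have h1 : ∀ v, Differentiable ℝ (dirDeriv v f) := fun v =>
    (hf.dirDeriv (k := 1) (by norm_num) v).differentiable one_ne_zero
  have h2 : ∀ v, Differentiable ℝ (dirDeriv v g) := fun v =>
    (hg.dirDeriv (k := 1) (by norm_num) v).differentiable one_ne_zero
  have e := dirDeriv_add (hf.differentiable two_ne_zero) (hg.differentiable two_ne_zero)
  unfold ellOp
  simp only [e, dirDeriv_add (h1 _) (h2 _), mul_add, Finset.sum_add_distrib]
  ring

theorem ellOp_const_mul {m : ℕ} (a : Fin m → Fin m → ℝ) (β : Fin m → ℝ) (γ : ℝ)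
    {f : (Fin m → ℝ) → ℝ} (hf : ContDiff ℝ 2 f) (c : ℝ) (y : Fin m → ℝ) :
    ellOp a β γ (fun y => c * f y) y = c * ellOp a β γ f y := by
  have h1 : ∀ v, Differentiable ℝ (dirDeriv v f) := fun v =>
    (hf.dirDeriv (k := 1) (by norm_num) v).differentiable one_ne_zero
  have e := dirDeriv_const_mul (hf.differentiable two_ne_zero) c
  unfold ellOp
  simp only [e, dirDeriv_const_mul (h1 _)]
  simp only [mul_left_comm _ c, ← Finset.mul_sum]
  ring

theorem ellOp_ge_of_isLocalMin {m : ℕ} {a : Fin m → Fin m → ℝ} (β : Fin m → ℝ) (γ : ℝ)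
    (ha : ∀ ξ : Fin m → ℝ, 0 ≤ ∑ i, ∑ j, a i j * ξ i * ξ j)
    {f : (Fin m → ℝ) → ℝ} (hf : ContDiff ℝ 2 f) {y : Fin m → ℝ} (hmin : IsLocalMin f y) :
    γ * f y ≤ ellOp a β γ f y := by
  have h := trace_hessian_nonneg_of_isLocalMin hf hmin ha
  unfold ellOp
  simp only [dirDeriv_eq_zero_of_isLocalMin hmin, mul_zero, Finset.sum_const_zero]
  linarith

/-! ### Gaussian barriers -/

/-- The square of the Euclidean norm. -/
def sqNorm {m : ℕ} (y : Fin m → ℝ) : ℝ := ∑ i, y i ^ 2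

theorem sqNorm_nonneg {m : ℕ} (y : Fin m → ℝ) : 0 ≤ sqNorm y :=
  Finset.sum_nonneg fun _ _ => sq_nonneg _

theorem contDiff_sqNorm {m : ℕ} {n : WithTop ℕ∞} : ContDiff ℝ n (sqNorm : (Fin m → ℝ) → ℝ) := by
  unfold sqNorm; fun_prop

theorem norm_sq_le_sqNorm {m : ℕ} (y : Fin m → ℝ) : ‖y‖ ^ 2 ≤ sqNorm y := by
  have : ‖y‖ ≤ √(sqNorm y) := by
    refine (pi_norm_le_iff_of_nonneg (Real.sqrt_nonneg _)).2 fun i => ?_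
    refine Real.le_sqrt_of_sq_le ?_
    rw [Real.norm_eq_abs, sq_abs]
    exact Finset.single_le_sum (f := fun i => y i ^ 2) (fun i _ => sq_nonneg _) (Finset.mem_univ i)
  calc ‖y‖ ^ 2 ≤ √(sqNorm y) ^ 2 := by gcongr
    _ = sqNorm y := Real.sq_sqrt (sqNorm_nonneg y)

theorem abs_apply_le_one_add_sqNorm {m : ℕ} (y : Fin m → ℝ) (i : Fin m) :
    |y i| ≤ 1 + sqNorm y := by
  have h : y i ^ 2 ≤ sqNorm y :=
    Finset.single_le_sum (f := fun i => y i ^ 2) (fun i _ => sq_nonneg _) (Finset.mem_univ i)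
  have := sq_abs (y i)
  nlinarith [sq_nonneg (|y i| - 1)]

theorem sqNorm_add_le {m : ℕ} (y p : Fin m → ℝ) :
    sqNorm (y + p) ≤ 2 * sqNorm y + 2 * sqNorm p := by
  unfold sqNorm
  rw [Finset.mul_sum, Finset.mul_sum, ← Finset.sum_add_distrib]
  refine Finset.sum_le_sum fun i _ => ?_
  simp only [Pi.add_apply]
  nlinarith [sq_nonneg (y i - p i)]

theorem sqNorm_le_of_norm_le {m : ℕ} {y : Fin m → ℝ} {R : ℝ} (h : ‖y‖ ≤ R) :
    sqNorm y ≤ m * R ^ 2 := by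
  have : ∀ i ∈ (Finset.univ : Finset (Fin m)), y i ^ 2 ≤ R ^ 2 := fun i _ => by
    have := (norm_le_pi_norm y i).trans h
    rw [Real.norm_eq_abs] at this
    exact sq_le_sq' (neg_le_of_abs_le this) (le_of_abs_le this)
  simpa [sqNorm] using Finset.sum_le_sum this

theorem dirDeriv_gaussian {m : ℕ} (g ν : ℝ) (i : Fin m) :
    dirDeriv (coordVec i) (fun y : Fin m → ℝ => Real.exp (g * sqNorm y + ν)) =
      fun y => 2 * g * y i * Real.exp (g * sqNorm y + ν) := by
  ext y
  have hl : HasDerivAt (fun s : ℝ => sqNorm (y + s • coordVec i)) (2 * y i) 0 := by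
    have h : ∀ j, HasDerivAt (fun s : ℝ => (y j + s * (coordVec i : Fin m → ℝ) j) ^ 2)
        (2 * y j * (coordVec i : Fin m → ℝ) j) 0 := fun j => by
      simpa using (((hasDerivAt_id (0 : ℝ)).mul_const ((coordVec i : Fin m → ℝ) j)).const_add
        (y j)).fun_pow 2
    have := HasDerivAt.fun_sum (u := Finset.univ) fun j _ => h j
    simpa [sqNorm, Pi.single_apply] using this
  have h2 := ((hl.const_mul g).add_const ν).exp
  have h1 := hasDerivAt_comp_line (f := fun y : Fin m → ℝ => Real.exp (g * sqNorm y + ν))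
    (by have := contDiff_sqNorm (m := m) (n := 1)
        exact (((contDiff_const.mul this).add contDiff_const).exp).differentiable one_ne_zero)
    y (coordVec i) 0
  have := h1.unique h2
  simp only [zero_smul, add_zero] at this
  rw [this]; ring

theorem dirDeriv_dirDeriv_gaussian {m : ℕ} (g ν : ℝ) (i j : Fin m) (y : Fin m → ℝ) :
    dirDeriv (coordVec i) (dirDeriv (coordVec j)
      (fun y : Fin m → ℝ => Real.exp (g * sqNorm y + ν))) y =
      (2 * g * (if i = j then 1 else 0) + 4 * g ^ 2 * y i * y j) *
        Real.exp (g * sqNorm y + ν) := by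
  have hg : ContDiff ℝ 2 fun y : Fin m → ℝ => Real.exp (g * sqNorm y + ν) :=
    ((contDiff_const.mul contDiff_sqNorm).add contDiff_const).exp
  have hd : Differentiable ℝ fun y : Fin m → ℝ => Real.exp (g * sqNorm y + ν) :=
    hg.differentiable two_ne_zero
  have e : dirDeriv (coordVec i) (fun y : Fin m → ℝ => Real.exp (g * sqNorm y + ν)) y = _ :=
    congrFun (dirDeriv_gaussian g ν i) y
  rw [dirDeriv_gaussian]
  unfold dirDeriv at e ⊢
  have hl : HasFDerivAt (fun y : Fin m → ℝ => 2 * g * y j)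
      ((2 * g) • ContinuousLinearMap.proj (R := ℝ) (φ := fun _ : Fin m => ℝ) j) y := by
    simpa using (ContinuousLinearMap.proj (R := ℝ) (φ := fun _ : Fin m => ℝ) j).hasFDerivAt.const_mul
      (2 * g)
  rw [(hl.fun_mul (hd y).hasFDerivAt).fderiv]
  simp only [add_apply, FunLike.coe_smul, Pi.smul_apply, smul_eq_mul,
    ContinuousLinearMap.proj_apply, e, Pi.single_apply]
  simp only [eq_comm (a := j)]
  ring

theorem abs_apply_mul_apply_le_sqNorm {m : ℕ} (y : Fin m → ℝ) (i j : Fin m) :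
    |y i * y j| ≤ sqNorm y := by
  have h : ∀ i, y i ^ 2 ≤ sqNorm y := fun i =>
    Finset.single_le_sum (f := fun i => y i ^ 2) (fun i _ => sq_nonneg _) (Finset.mem_univ i)
  have := h i
  have := h j
  rw [abs_le]
  constructor <;> nlinarith [sq_nonneg (y i - y j), sq_nonneg (y i + y j)]

/-- Two derivatives of a Gaussian cost a factor at most affine in `sqNorm y`. Only the upper bound
`G` enters that factor, so it stays fixed while `g` varies in time. -/
theorem ellOp_gaussian_le {m : ℕ} {a : Fin m → Fin m → ℝ} {β : Fin m → ℝ} {γ M g G : ℝ} (ν : ℝ)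
    (ha : ∀ i j, |a i j| ≤ M) (hβ : ∀ i, |β i| ≤ M) (hγ : |γ| ≤ M) (hg : 0 ≤ g) (hG : g ≤ G)
    (y : Fin m → ℝ) :
    ellOp a β γ (fun y => Real.exp (g * sqNorm y + ν)) y ≤
      ((1 / 2 : ℝ) * (m * (m * (M * (2 * G + 4 * G ^ 2 * sqNorm y))))
        + m * (M * (2 * G * (1 + sqNorm y))) + M) * Real.exp (g * sqNorm y + ν) := by
  have hM : 0 ≤ M := (abs_nonneg _).trans hγ
  have hq := sqNorm_nonneg y
  unfold ellOp
  simp only [dirDeriv_dirDeriv_gaussian]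
  simp only [dirDeriv_gaussian, ← mul_assoc, ← Finset.sum_mul]
  rw [← add_mul, ← add_mul]
  refine mul_le_mul_of_nonneg_right ?_ (Real.exp_nonneg _)
  simp only [mul_assoc]
  have h1 : ∀ i j, a i j * (2 * (g * if i = j then 1 else 0) + 4 * (g ^ 2 * (y i * y j))) ≤
      M * (2 * G + 4 * G ^ 2 * sqNorm y) := by
    intro i j
    refine (le_abs_self _).trans ?_
    rw [abs_mul]
    refine mul_le_mul (ha i j) ?_ (abs_nonneg _) hM
    refine (abs_add_le _ _).trans (add_le_add ?_ ?_)
    · split_ifs <;> simp [abs_of_nonneg hg] <;> linarith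
    · rw [abs_mul, abs_mul, abs_of_nonneg (by norm_num : (0 : ℝ) ≤ 4), mul_assoc,
        abs_of_nonneg (by positivity : 0 ≤ g ^ 2)]
      gcongr
      exact abs_apply_mul_apply_le_sqNorm y i j
  have h2 : ∀ i, β i * (2 * (g * y i)) ≤ M * (2 * G * (1 + sqNorm y)) := by
    intro i
    refine (le_abs_self _).trans ?_
    rw [abs_mul]
    refine mul_le_mul (hβ i) ?_ (abs_nonneg _) hM
    rw [abs_mul, abs_mul, abs_of_nonneg (by norm_num : (0 : ℝ) ≤ 2), mul_assoc, abs_of_nonneg hg]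
    have := abs_apply_le_one_add_sqNorm y i
    gcongr
    exact hg.trans hG
  have h3 : ∑ i, ∑ j, a i j * (2 * (g * if i = j then 1 else 0) + 4 * (g ^ 2 * (y i * y j))) ≤
      m * (m * (M * (2 * G + 4 * G ^ 2 * sqNorm y))) := by
    refine (Finset.sum_le_sum fun i _ => Finset.sum_le_sum fun j _ => h1 i j).trans ?_
    simp
  have h4 : ∑ i, β i * (2 * (g * y i)) ≤ m * (M * (2 * G * (1 + sqNorm y))) := by
    refine (Finset.sum_le_sum fun i _ => h2 i).trans ?_
    simp
  have h5 := (le_abs_self γ).trans hγ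
  simp only [mul_assoc] at h3 h4 ⊢
  linarith

/-! ### Classical minimum principles -/

/-- Minimum principle on a bounded cylinder for a strict supersolution that is positive
initially and far away. -/
theorem pos_of_strict_supersolution {m : ℕ} {s₀ s₁ R M : ℝ}
    {a : Fin m → Fin m → ℝ → ℝ} {β : Fin m → ℝ → ℝ} {γ : ℝ → ℝ}
    (ha : ∀ τ ∈ Ioc s₀ s₁, ∀ ξ : Fin m → ℝ, 0 ≤ ∑ i, ∑ j, a i j τ * ξ i * ξ j)
    (hγ : ∀ τ ∈ Ioc s₀ s₁, |γ τ| ≤ M)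
    {w w' : (Fin m → ℝ) → ℝ → ℝ}
    (hcont : ContinuousOn (fun p : (Fin m → ℝ) × ℝ => w p.1 p.2) (univ ×ˢ Icc s₀ s₁))
    (hsmooth : ∀ τ ∈ Ioc s₀ s₁, ContDiff ℝ 2 fun y => w y τ)
    (hderiv : ∀ y, ∀ τ ∈ Ioc s₀ s₁, HasDerivAt (fun s => w y s) (w' y τ) τ)
    (hsuper : ∀ y, ∀ τ ∈ Ioc s₀ s₁,
      ellOp (fun i j => a i j τ) (fun i => β i τ) (γ τ) (fun y => w y τ) y < w' y τ)
    (hinit : ∀ y, 0 < w y s₀) (hfar : ∀ y, R < ‖y‖ → ∀ τ ∈ Icc s₀ s₁, 0 < w y τ) :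
    ∀ y, ∀ τ ∈ Icc s₀ s₁, 0 < w y τ := by
  intro y₀ τ₀ hτ₀
  by_contra! hneg
  set S : Set ((Fin m → ℝ) × ℝ) := Metric.closedBall 0 R ×ˢ Icc s₀ s₁
  have hS : IsCompact S := (isCompact_closedBall 0 R).prod isCompact_Icc
  have hmem : (y₀, τ₀) ∈ S := by
    refine ⟨?_, hτ₀⟩
    by_contra hfar'
    exact absurd (hfar y₀ (by simpa using hfar') τ₀ hτ₀) (not_lt.2 hneg)
  -- The factor `exp (-M τ)` absorbs the zeroth-order term: at a nonpositive minimum of `W`, `M w ≤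
  -- γ w ≤ ellOp w < w' ≤ M w`, whatever the sign of `γ`.
  set W : (Fin m → ℝ) × ℝ → ℝ := fun p => Real.exp (-M * p.2) * w p.1 p.2 with hW
  have hWc : ContinuousOn W S :=
    (by fun_prop : Continuous fun p : (Fin m → ℝ) × ℝ => Real.exp (-M * p.2)).continuousOn.mul
      (hcont.mono (prod_mono (subset_univ _) subset_rfl))
  obtain ⟨⟨y, τ⟩, hp, hmin⟩ := hS.exists_isMinOn ⟨_, hmem⟩ hWc
  have hτ : τ ∈ Icc s₀ s₁ := hp.2
  have hw0 : w y τ ≤ 0 := by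
    have h1 : W (y, τ) ≤ W (y₀, τ₀) := hmin hmem
    have h2 : W (y₀, τ₀) ≤ 0 := mul_nonpos_of_nonneg_of_nonpos (Real.exp_nonneg _) hneg
    exact nonpos_of_mul_nonpos_right (h1.trans h2) (Real.exp_pos _)
  have hglob : ∀ z, ∀ s ∈ Icc s₀ s₁, W (y, τ) ≤ W (z, s) := by
    intro z s hs
    by_cases hz : ‖z‖ ≤ R
    · exact hmin (show (z, s) ∈ S from ⟨by simpa using hz, hs⟩)
    · have h1 : W (y, τ) ≤ 0 := mul_nonpos_of_nonneg_of_nonpos (Real.exp_nonneg _) hw0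
      have h2 : 0 < W (z, s) := mul_pos (Real.exp_pos _) (hfar z (not_le.1 hz) s hs)
      linarith
  have hτ' : τ ∈ Ioc s₀ s₁ := by
    refine ⟨lt_of_le_of_ne hτ.1 fun h => ?_, hτ.2⟩
    subst h
    exact absurd (hinit y) (not_lt.2 hw0)
  have hspace : IsLocalMin (fun z => w z τ) y := by
    refine Filter.Eventually.of_forall fun z => ?_
    exact le_of_mul_le_mul_left (hglob z τ hτ) (Real.exp_pos _)
  have htime : w' y τ ≤ M * w y τ := by
    have hd : HasDerivAt (fun s => W (y, s))
        (Real.exp (-M * τ) * (-M * 1) * w y τ + Real.exp (-M * τ) * w' y τ) τ :=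
      (((hasDerivAt_id τ).const_mul (-M)).exp).mul (hderiv y τ hτ')
    have hle : Real.exp (-M * τ) * (-M * 1) * w y τ + Real.exp (-M * τ) * w' y τ ≤ 0 := by
      -- Only difference quotients from the left are used, since the minimum may occur at the final
      -- time `s₁`.
      have hslope := (hasDerivWithinAt_iff_tendsto_slope' (s := Iio τ) (by simp)).1
        (hd.hasDerivWithinAt (s := Iio τ))
      refine le_of_tendsto hslope ?_
      filter_upwards [Ioo_mem_nhdsLT hτ'.1] with s hs
      rw [slope_def_field]
      refine div_nonpos_of_nonneg_of_nonpos ?_ (by linarith [hs.2])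
      linarith [hglob y s ⟨hs.1.le, hs.2.le.trans hτ.2⟩]
    have : Real.exp (-M * τ) * (w' y τ - M * w y τ) ≤ 0 := by linarith
    have := nonpos_of_mul_nonpos_right this (Real.exp_pos _)
    linarith
  have h1 := ellOp_ge_of_isLocalMin (fun i => β i τ) (γ τ) (ha τ hτ') (hsmooth τ hτ') hspace
  have h2 := hsuper y τ hτ'
  have h3 : M * w y τ ≤ γ τ * w y τ :=
    mul_le_mul_of_nonpos_right ((le_abs_self _).trans (hγ τ hτ')) hw0
  linarith

/-- Tychonoff's minimum principle on a short time interval, whose length depends only on the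
bounds of the coefficients and on the growth rate. -/
theorem exists_short_time_nonneg (m : ℕ) {M k : ℝ} (hM : 0 ≤ M) (hk : 0 ≤ k) :
    ∃ δ : ℝ, 0 < δ ∧ ∀ (s₀ s₁ C : ℝ), s₁ ≤ s₀ + δ →
    ∀ (a : Fin m → Fin m → ℝ → ℝ) (β : Fin m → ℝ → ℝ) (γ : ℝ → ℝ)
      (v v' : (Fin m → ℝ) → ℝ → ℝ),
    (∀ τ ∈ Ioc s₀ s₁, ∀ ξ : Fin m → ℝ, 0 ≤ ∑ i, ∑ j, a i j τ * ξ i * ξ j) →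
    (∀ τ ∈ Ioc s₀ s₁, ∀ i j, |a i j τ| ≤ M) →
    (∀ τ ∈ Ioc s₀ s₁, ∀ i, |β i τ| ≤ M) →
    (∀ τ ∈ Ioc s₀ s₁, |γ τ| ≤ M) →
    ContinuousOn (fun p : (Fin m → ℝ) × ℝ => v p.1 p.2) (univ ×ˢ Icc s₀ s₁) →
    (∀ τ ∈ Ioc s₀ s₁, ContDiff ℝ 2 fun y => v y τ) →
    (∀ y, ∀ τ ∈ Ioc s₀ s₁, HasDerivAt (fun s => v y s) (v' y τ) τ) →
    (∀ y, ∀ τ ∈ Ioc s₀ s₁,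
      ellOp (fun i j => a i j τ) (fun i => β i τ) (γ τ) (fun y => v y τ) y ≤ v' y τ) →
    (∀ y, 0 ≤ v y s₀) →
    (∀ y, ∀ τ ∈ Icc s₀ s₁, -C * Real.exp (k * sqNorm y) ≤ v y τ) →
    ∀ y, ∀ τ ∈ Icc s₀ s₁, 0 ≤ v y τ := by
  -- `G` bounds the barrier's exponent `g`, which starts at `k + 1` and at most doubles in time `1 /
  -- μ`. `C₁` and `C₂` are the constant and the coefficient of `sqNorm y` in `ellOp_gaussian_le`.
  set G : ℝ := 2 * (k + 1) with hG
  set C₂ : ℝ := 2 * m * m * M * G ^ 2 + 2 * m * M * G with hC₂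
  set C₁ : ℝ := m * m * M * G + 2 * m * M * G + M with hC₁
  have hG0 : 0 ≤ G := by positivity
  have hC₂0 : 0 ≤ C₂ := by positivity
  -- With this rate, the time derivative of `g` contributes at least `C₂ * sqNorm y` to the
  -- logarithmic derivative of the barrier; the rate `C₁ + 1` contributes the rest, strictly.
  set μ : ℝ := C₂ + 1 with hμ
  have hμ0 : 0 < μ := by positivity
  refine ⟨1 / μ, by positivity, ?_⟩
  intro s₀ s₁ C hs a β γ v v' hpsd ha hβ hγ hcont hsmooth hderiv hsuper hinit hlow y₀ τ₀ hτ₀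
  set g : ℝ → ℝ := fun τ => (k + 1) * (1 + μ * (τ - s₀)) with hg
  set B : (Fin m → ℝ) → ℝ → ℝ := fun y τ => Real.exp (g τ * sqNorm y + (C₁ + 1) * (τ - s₀))
    with hB
  have hg1 : ∀ τ ∈ Icc s₀ s₁, k + 1 ≤ g τ := fun τ hτ => by
    have : 0 ≤ μ * (τ - s₀) := mul_nonneg hμ0.le (by linarith [hτ.1])
    simp only [hg]; nlinarith
  have hg2 : ∀ τ ∈ Icc s₀ s₁, g τ ≤ G := fun τ hτ => by
    have : μ * (τ - s₀) ≤ 1 := by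
      calc μ * (τ - s₀) ≤ μ * (1 / μ) := by gcongr; linarith [hτ.2]
        _ = 1 := by field_simp
    simp only [hg, hG]; nlinarith
  have hBc : ∀ τ, ContDiff ℝ 2 fun y => B y τ := fun τ =>
    ((contDiff_const.mul contDiff_sqNorm).add contDiff_const).exp
  have hBd : ∀ y τ, HasDerivAt (fun s => B y s)
      (B y τ * ((k + 1) * μ * sqNorm y + (C₁ + 1))) τ := fun y τ => by
    have h1 : HasDerivAt g ((k + 1) * (μ * 1)) τ :=
      ((((hasDerivAt_id τ).sub_const s₀).const_mul μ).const_add 1).const_mul (k + 1)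
    have h2 : HasDerivAt (fun τ => (C₁ + 1) * (τ - s₀)) ((C₁ + 1) * 1) τ :=
      ((hasDerivAt_id τ).sub_const s₀).const_mul _
    convert ((h1.mul_const (sqNorm y)).fun_add h2).exp using 1
    simp only [hB]; ring
  have key : ∀ η : ℝ, 0 < η → ∀ y, ∀ τ ∈ Icc s₀ s₁, 0 < v y τ + η * B y τ := by
    intro η hη
    have hBpos : ∀ y τ, 0 < B y τ := fun y τ => Real.exp_pos _
    have hBcont : Continuous fun p : (Fin m → ℝ) × ℝ => B p.1 p.2 := by
      have := (contDiff_sqNorm (m := m) (n := 0)).continuous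
      simp only [hB, hg]; fun_prop
    -- Since `g ≥ k + 1`, the barrier exceeds the allowed growth by a factor `exp (sqNorm y)`.
    -- Beyond this radius that factor is larger than `|C| / η`; the `1` ensures `‖y‖ ≤ sqNorm y`.
    refine pos_of_strict_supersolution (R := max 1 (|C| / η)) (M := M) (a := a) (β := β) (γ := γ)
      (w' := fun y τ => v' y τ + η * (B y τ * ((k + 1) * μ * sqNorm y + (C₁ + 1)))) hpsd hγ
      (hcont.add (continuous_const.mul hBcont).continuousOn)
      (fun τ hτ => (hsmooth τ hτ).add (contDiff_const.mul (hBc τ)))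
      (fun y τ hτ => (hderiv y τ hτ).add ((hBd y τ).const_mul η)) ?_ ?_ ?_
    · intro y τ hτ
      have hτ' : τ ∈ Icc s₀ s₁ := Ioc_subset_Icc_self hτ
      rw [ellOp_add _ _ _ (hsmooth τ hτ) (contDiff_const.mul (hBc τ)), ellOp_const_mul _ _ _ (hBc τ)]
      refine add_lt_add_of_le_of_lt (hsuper y τ hτ) (mul_lt_mul_of_pos_left ?_ hη)
      refine (ellOp_gaussian_le _ (ha τ hτ) (hβ τ hτ) (hγ τ hτ)
        (by linarith [hg1 τ hτ']) (hg2 τ hτ') y).trans_lt ?_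
      rw [mul_comm]
      refine mul_lt_mul_of_pos_left ?_ (hBpos y τ)
      have e : (1 / 2 : ℝ) * (m * (m * (M * (2 * G + 4 * G ^ 2 * sqNorm y))))
        + m * (M * (2 * G * (1 + sqNorm y))) + M = C₁ + C₂ * sqNorm y := by
        simp only [hC₁, hC₂]; ring
      rw [e]
      have hq := sqNorm_nonneg y
      have : C₂ * sqNorm y ≤ (k + 1) * μ * sqNorm y := by
        refine mul_le_mul_of_nonneg_right ?_ hq
        simp only [hμ]; nlinarith [mul_nonneg hk hC₂0]
      linarith
    · intro y
      exact add_pos_of_nonneg_of_pos (hinit y) (mul_pos hη (hBpos y s₀))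
    · intro y hy τ hτ
      have h1 := hlow y τ hτ
      have hq := sqNorm_nonneg y
      have hy1 : 1 < ‖y‖ := (le_max_left _ _).trans_lt hy
      have hy2 : |C| / η < ‖y‖ := (le_max_right _ _).trans_lt hy
      have hy3 : ‖y‖ ≤ sqNorm y := by nlinarith [norm_sq_le_sqNorm y]
      have h2 : |C| < η * Real.exp (sqNorm y) := by
        have : |C| < ‖y‖ * η := (div_lt_iff₀ hη).1 hy2
        nlinarith [Real.add_one_le_exp (sqNorm y)]
      have hC1 : 0 ≤ C₁ := by positivity
      have h3 : Real.exp (k * sqNorm y) * Real.exp (sqNorm y) ≤ B y τ := by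
        rw [← Real.exp_add]
        refine Real.exp_le_exp.2 ?_
        have : 0 ≤ (C₁ + 1) * (τ - s₀) := mul_nonneg (by linarith) (by linarith [hτ.1])
        nlinarith [mul_le_mul_of_nonneg_right (hg1 τ hτ) hq]
      have h4 : C * Real.exp (k * sqNorm y) < η * B y τ := by
        calc C * Real.exp (k * sqNorm y) ≤ |C| * Real.exp (k * sqNorm y) := by
              gcongr; exact le_abs_self C
          _ < η * Real.exp (sqNorm y) * Real.exp (k * sqNorm y) := by gcongr
          _ = η * (Real.exp (k * sqNorm y) * Real.exp (sqNorm y)) := by ring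
          _ ≤ η * B y τ := by gcongr
      linarith
  -- Let `η` tend to `0` at the fixed point `(y₀, τ₀)`.
  refine le_of_forall_pos_lt_add fun ε hε => ?_
  have hBp : 0 < B y₀ τ₀ := Real.exp_pos _
  have := key (ε / B y₀ τ₀) (by positivity) y₀ τ₀ hτ₀
  rwa [div_mul_cancel₀ _ hBp.ne'] at this

/-! ### Test functions and mollification -/

/-- Smooth functions with compact support. -/
structure IsTest {m : ℕ} (ζ : (Fin m → ℝ) → ℝ) : Prop where
  contDiff : ContDiff ℝ ((⊤ : ℕ∞) : WithTop ℕ∞) ζ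
  compact : HasCompactSupport ζ

namespace IsTest

variable {m : ℕ} {ζ : (Fin m → ℝ) → ℝ}

theorem continuous (h : IsTest ζ) : Continuous ζ := h.contDiff.continuous

theorem differentiable (h : IsTest ζ) : Differentiable ℝ ζ := h.contDiff.differentiable (by simp)

theorem contDiff_two (h : IsTest ζ) : ContDiff ℝ 2 ζ := h.contDiff.of_le (by norm_cast)

theorem dirDeriv (h : IsTest ζ) (v : Fin m → ℝ) : IsTest (dirDeriv v ζ) :=
  ⟨h.contDiff.dirDeriv (by simp) v, h.compact.fderiv_apply ℝ v⟩

theorem add {ψ : (Fin m → ℝ) → ℝ} (h : IsTest ζ) (h' : IsTest ψ) :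
    IsTest fun y => ζ y + ψ y := ⟨h.contDiff.add h'.contDiff, h.compact.add h'.compact⟩

theorem const_mul (h : IsTest ζ) (c : ℝ) : IsTest fun y => c * ζ y :=
  ⟨contDiff_const.mul h.contDiff, h.compact.mul_left⟩

theorem sum {ι : Type*} {s : Finset ι} {ψ : ι → (Fin m → ℝ) → ℝ} (h : ∀ i, IsTest (ψ i)) :
    IsTest fun y => ∑ i ∈ s, ψ i y := by
  classical
  induction s using Finset.induction_on with
  | empty => exact ⟨by simpa using contDiff_const, by simpa using! HasCompactSupport.zero⟩
  | insert i s hi ih => simpa [Finset.sum_insert hi] using (h i).add ih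

theorem ellOp (h : IsTest ζ) (a : Fin m → Fin m → ℝ) (β : Fin m → ℝ) (γ : ℝ) :
    IsTest (ellOp a β γ ζ) :=
  (((sum fun i => sum fun j => ((h.dirDeriv _).dirDeriv _).const_mul (a i j)).const_mul _).add
    (sum fun i => (h.dirDeriv _).const_mul (β i))).add (h.const_mul γ)

theorem comp_sub_left (h : IsTest ζ) (y : Fin m → ℝ) : IsTest fun w => ζ (y - w) :=
  ⟨h.contDiff.comp (contDiff_const.sub contDiff_id),
    h.compact.comp_homeomorph (Homeomorph.subLeft y)⟩

theorem comp_sub_right (h : IsTest ζ) (p : Fin m → ℝ) : IsTest fun w => ζ (w - p) :=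
  ⟨h.contDiff.comp (contDiff_id.sub contDiff_const),
    h.compact.comp_homeomorph (Homeomorph.subRight p)⟩

theorem integrable_mul (h : IsTest ζ) {u : (Fin m → ℝ) → ℝ} (hu : Continuous u) :
    Integrable fun w => u w * ζ w :=
  (hu.mul h.continuous).integrable_of_hasCompactSupport h.compact.mul_left

end IsTest

theorem dirDeriv_comp_sub_left {m : ℕ} {ζ : (Fin m → ℝ) → ℝ} (h : Differentiable ℝ ζ)
    (y v : Fin m → ℝ) :
    dirDeriv v (fun w => ζ (y - w)) = fun w => -1 * dirDeriv v ζ (y - w) := by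
  ext w
  have h1 : HasFDerivAt (fun w : Fin m → ℝ => y - w) (-ContinuousLinearMap.id ℝ _) w :=
    (hasFDerivAt_id w).const_sub y
  have := (h (y - w)).hasFDerivAt.comp w h1
  unfold dirDeriv
  rw [show (fun w => ζ (y - w)) = ζ ∘ (fun w => y - w) from rfl, this.fderiv]
  simp

theorem dirDeriv_comp_sub_right {m : ℕ} (ζ : (Fin m → ℝ) → ℝ) (p v : Fin m → ℝ) :
    dirDeriv v (fun w => ζ (w - p)) = fun w => dirDeriv v ζ (w - p) := by
  ext w
  simp [dirDeriv, fderiv_comp_sub]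

/-- Reflection changes the sign of odd-order derivatives only. Hence the adjoint operator, with
drift `-β`, acting in `w` on `ζ (y - w)` agrees with the original operator applied to `ζ`. -/
theorem ellOp_comp_sub_left {m : ℕ} {ζ : (Fin m → ℝ) → ℝ} (h : IsTest ζ)
    (a : Fin m → Fin m → ℝ) (β : Fin m → ℝ) (γ : ℝ) (y w : Fin m → ℝ) :
    ellOp a (fun i => -β i) γ (fun w => ζ (y - w)) w = ellOp a β γ ζ (y - w) := by
  unfold ellOp
  simp only [dirDeriv_comp_sub_left h.differentiable,
    dirDeriv_const_mul ((h.dirDeriv _).comp_sub_left y).differentiable,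
    dirDeriv_comp_sub_left (h.dirDeriv _).differentiable]
  simp

theorem ellOp_comp_sub_right {m : ℕ} (ζ : (Fin m → ℝ) → ℝ)
    (a : Fin m → Fin m → ℝ) (β : Fin m → ℝ) (γ : ℝ) (p w : Fin m → ℝ) :
    ellOp a β γ (fun w => ζ (w - p)) w = ellOp a β γ ζ (w - p) := by
  unfold ellOp
  simp only [dirDeriv_comp_sub_right]

/-- Integrals of a continuous function against a test function depend linearly on the latter. -/
theorem integral_mul_ellOp {m : ℕ} {u ζ : (Fin m → ℝ) → ℝ} (hu : Continuous u) (h : IsTest ζ)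
    (a : Fin m → Fin m → ℝ) (β : Fin m → ℝ) (γ : ℝ) :
    ∫ w, u w * ellOp a β γ ζ w =
      (1 / 2 : ℝ) * ∑ i, ∑ j, a i j *
          (∫ w, u w * dirDeriv (coordVec i) (dirDeriv (coordVec j) ζ) w)
        + ∑ i, β i * (∫ w, u w * dirDeriv (coordVec i) ζ w) + γ * ∫ w, u w * ζ w := by
  have h0 := (h.integrable_mul hu).const_mul γ
  have h1 : ∀ i, Integrable fun w => β i * (u w * dirDeriv (coordVec i) ζ w) := fun i =>
    ((h.dirDeriv _).integrable_mul hu).const_mul _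
  have h2 : ∀ i j, Integrable fun w =>
      a i j * (u w * dirDeriv (coordVec i) (dirDeriv (coordVec j) ζ) w) := fun i j =>
    (((h.dirDeriv _).dirDeriv _).integrable_mul hu).const_mul _
  have e : ∀ w, u w * ellOp a β γ ζ w =
      (1 / 2 : ℝ) * ∑ i, ∑ j, a i j *
          (u w * dirDeriv (coordVec i) (dirDeriv (coordVec j) ζ) w)
        + ∑ i, β i * (u w * dirDeriv (coordVec i) ζ w) + γ * (u w * ζ w) := by
    intro w
    unfold ellOp
    simp only [mul_add, Finset.mul_sum, mul_left_comm (u w)]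
  simp only [e]
  have i2 : ∀ i, Integrable fun w => ∑ j, a i j *
      (u w * dirDeriv (coordVec i) (dirDeriv (coordVec j) ζ) w) := fun i =>
    integrable_finsetSum _ fun j _ => h2 i j
  have I2 := (integrable_finsetSum Finset.univ fun i _ => i2 i).const_mul (1 / 2 : ℝ)
  have I1 := integrable_finsetSum Finset.univ fun i _ => h1 i
  rw [integral_add (I2.fun_add I1) h0, integral_add I2 I1, integral_const_mul, integral_const_mul,
    integral_finsetSum _ fun i _ => i2 i, integral_finsetSum _ fun i _ => h1 i]
  simp only [integral_finsetSum _ fun j _ => h2 _ j, integral_const_mul]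

theorem mollify_eq_convolution {m : ℕ} (u ζ : (Fin m → ℝ) → ℝ) :
    (fun y => ∫ w, u w * ζ (y - w)) =
      convolution u ζ (ContinuousLinearMap.mul ℝ ℝ) volume := by
  ext y; simp [convolution]

theorem contDiff_mollify {m : ℕ} {u ζ : (Fin m → ℝ) → ℝ} (hu : Continuous u) (h : IsTest ζ) :
    ContDiff ℝ 2 fun y => ∫ w, u w * ζ (y - w) := by
  rw [mollify_eq_convolution]
  exact h.compact.contDiff_convolution_right (n := 2) _ hu.locallyIntegrable h.contDiff_two

theorem dirDeriv_mollify {m : ℕ} {u ζ : (Fin m → ℝ) → ℝ} (hu : Continuous u) (h : IsTest ζ)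
    (v : Fin m → ℝ) :
    dirDeriv v (fun y => ∫ w, u w * ζ (y - w)) = fun y => ∫ w, u w * dirDeriv v ζ (y - w) := by
  ext y
  have h1 := h.compact.hasFDerivAt_convolution_right (ContinuousLinearMap.mul ℝ ℝ)
    (hu.locallyIntegrable (μ := volume)) (h.contDiff.of_le (by norm_cast)) y
  rw [mollify_eq_convolution]
  unfold dirDeriv
  rw [h1.fderiv, convolution_precompR_apply]
  · simp [convolution]
  · exact hu.locallyIntegrable
  · exact h.compact.fderiv ℝ
  · exact h.contDiff.continuous_fderiv (by simp)

theorem ellOp_mollify {m : ℕ} {u ζ : (Fin m → ℝ) → ℝ} (hu : Continuous u) (h : IsTest ζ)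
    (a : Fin m → Fin m → ℝ) (β : Fin m → ℝ) (γ : ℝ) (y : Fin m → ℝ) :
    ellOp a β γ (fun y => ∫ w, u w * ζ (y - w)) y = ∫ w, u w * ellOp a β γ ζ (y - w) := by
  have e : ∀ w, ellOp a β γ ζ (y - w) = ellOp a (fun i => -β i) γ (fun w => ζ (y - w)) w :=
    fun w => (ellOp_comp_sub_left h a β γ y w).symm
  simp only [e]
  rw [integral_mul_ellOp hu (h.comp_sub_left y)]
  unfold ellOp
  simp only [dirDeriv_mollify hu h, dirDeriv_mollify hu (h.dirDeriv _),
    dirDeriv_comp_sub_left h.differentiable,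
    dirDeriv_const_mul ((h.dirDeriv _).comp_sub_left y).differentiable,
    dirDeriv_comp_sub_left (h.dirDeriv _).differentiable]
  simp [integral_neg]

/-- `K` and `R` depend on `ζ` and `M` but not on the coefficients, so one bound serves all times. -/
theorem exists_ellOp_bound {m : ℕ} {ζ : (Fin m → ℝ) → ℝ} (h : IsTest ζ) (M : ℝ) :
    ∃ K R : ℝ, 0 ≤ K ∧ ∀ (a : Fin m → Fin m → ℝ) (β : Fin m → ℝ) (γ : ℝ),
      (∀ i j, |a i j| ≤ M) → (∀ i, |β i| ≤ M) → |γ| ≤ M →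
      ∀ w, |ellOp a β γ ζ w| ≤ (Metric.closedBall 0 R).indicator (fun _ => K) w := by
  have hb : ∀ ψ : (Fin m → ℝ) → ℝ, IsTest ψ → ∃ K : ℝ, ∀ w, |ψ w| ≤ K := fun ψ hψ => by
    obtain ⟨K, hK⟩ := hψ.compact.exists_bound_of_continuous hψ.continuous
    exact ⟨K, hK⟩
  choose K2 hK2 using fun i j : Fin m => hb _ ((h.dirDeriv (coordVec j)).dirDeriv (coordVec i))
  choose K1 hK1 using fun i : Fin m => hb _ (h.dirDeriv (coordVec i))
  obtain ⟨K0, hK0⟩ := hb _ h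
  obtain ⟨R, hR⟩ := h.compact.isCompact.isBounded.subset_closedBall 0
  refine ⟨|(1 / 2 : ℝ) * ∑ i, ∑ j, M * K2 i j + ∑ i, M * K1 i + M * K0|, R, abs_nonneg _,
    fun a β γ ha hβ hγ w => ?_⟩
  have hM : 0 ≤ M := (abs_nonneg _).trans hγ
  by_cases hw : w ∈ Metric.closedBall (0 : Fin m → ℝ) R
  · rw [indicator_of_mem hw]
    refine le_trans ?_ (le_abs_self _)
    unfold ellOp
    refine (abs_add_le _ _).trans (add_le_add ((abs_add_le _ _).trans (add_le_add ?_ ?_)) ?_)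
    · rw [abs_mul, abs_of_nonneg (by norm_num : (0 : ℝ) ≤ 1 / 2)]
      gcongr
      refine (Finset.abs_sum_le_sum_abs _ _).trans (Finset.sum_le_sum fun i _ => ?_)
      refine (Finset.abs_sum_le_sum_abs _ _).trans (Finset.sum_le_sum fun j _ => ?_)
      rw [abs_mul]
      exact mul_le_mul (ha i j) (hK2 i j w) (abs_nonneg _) hM
    · refine (Finset.abs_sum_le_sum_abs _ _).trans (Finset.sum_le_sum fun i _ => ?_)
      rw [abs_mul]
      exact mul_le_mul (hβ i) (hK1 i w) (abs_nonneg _) hM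
    · rw [abs_mul]
      exact mul_le_mul hγ (hK0 w) (abs_nonneg _) hM
  · rw [indicator_of_notMem hw]
    have h0 : w ∉ tsupport ζ := fun h' => hw (hR h')
    have hsub : ∀ ψ : (Fin m → ℝ) → ℝ, w ∉ tsupport ψ → ∀ v, w ∉ tsupport (dirDeriv v ψ) :=
      fun ψ hψ v h' => hψ (tsupport_fderiv_apply_subset (f := ψ) ℝ v h')
    have h1 : ∀ i, dirDeriv (coordVec i) ζ w = 0 := fun i =>
      image_eq_zero_of_notMem_tsupport (hsub _ h0 _)
    have h2 : ∀ i j, dirDeriv (coordVec i) (dirDeriv (coordVec j) ζ) w = 0 := fun i j =>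
      image_eq_zero_of_notMem_tsupport (hsub _ (hsub _ h0 _) _)
    simp [ellOp, h1, h2, image_eq_zero_of_notMem_tsupport h0]

theorem abs_integral_mul_le_of_indicator_bound {m : ℕ} {u ψ : (Fin m → ℝ) → ℝ}
    (hu : Continuous u) {K R : ℝ} (y : Fin m → ℝ)
    (hψ : ∀ w, |ψ w| ≤ (Metric.closedBall 0 R).indicator (fun _ => K) w) :
    |∫ w, u w * ψ (y - w)| ≤ K * ∫ w in Metric.closedBall y R, |u w| := by
  rw [← integral_const_mul, ← integral_indicator Metric.isClosed_closedBall.measurableSet]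
  rw [← Real.norm_eq_abs]
  refine norm_integral_le_of_norm_le ?_ (Eventually.of_forall fun w => ?_)
  · refine IntegrableOn.integrable_indicator ?_ Metric.isClosed_closedBall.measurableSet
    exact (hu.abs.continuousOn.integrableOn_compact (isCompact_closedBall y R)).const_mul K
  · have := hψ (y - w)
    rw [Real.norm_eq_abs, abs_mul]
    by_cases hw : w ∈ Metric.closedBall y R
    · have hw' : y - w ∈ Metric.closedBall (0 : Fin m → ℝ) R := by
        simpa [dist_eq_norm, norm_sub_rev] using hw
      rw [indicator_of_mem hw'] at this
      rw [indicator_of_mem hw, mul_comm]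
      gcongr
    · have hw' : y - w ∉ Metric.closedBall (0 : Fin m → ℝ) R := by
        simpa [dist_eq_norm, norm_sub_rev] using hw
      rw [indicator_of_notMem hw'] at this
      rw [indicator_of_notMem hw, le_antisymm this (abs_nonneg _), mul_zero]

/-! ### Weak solutions and their minimum principle -/

/-- `u` is a continuous function on `ℝ^m × [0, T)` of Gaussian growth, in the integral sense, that
solves `∂_τ u = ½ ∑ a_{ij}(τ) ∂_i ∂_j u + ∑ β_i(τ) ∂_i u + γ(τ) u + f` on `ℝ^m × (0, T)` in the
sense of distributions in space. -/
structure IsWeakSol {m : ℕ} (T : ℝ) (a : Fin m → Fin m → ℝ → ℝ) (β : Fin m → ℝ → ℝ) (γ : ℝ → ℝ)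
    (f u : (Fin m → ℝ) → ℝ → ℝ) : Prop where
  cont : ContinuousOn (fun p : (Fin m → ℝ) × ℝ => u p.1 p.2) (univ ×ˢ Ico 0 T)
  cont_source : ∀ τ ∈ Ioo 0 T, Continuous fun y => f y τ
  weak : ∀ ζ, IsTest ζ → ∀ τ ∈ Ioo 0 T, HasDerivAt (fun s => ∫ w, u w s * ζ w)
    ((∫ w, u w τ * ellOp (fun i j => a i j τ) (fun i => -β i τ) (γ τ) ζ w)
      + ∫ w, f w τ * ζ w) τ
  growth : ∃ k : ℝ, 0 < k ∧ IntegrableOn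
    (fun p : (Fin m → ℝ) × ℝ => u p.1 p.2 * Real.exp (-k * sqNorm p.1)) (univ ×ˢ Ioo 0 T)

namespace IsWeakSol

variable {m : ℕ} {T : ℝ} {a : Fin m → Fin m → ℝ → ℝ} {β : Fin m → ℝ → ℝ} {γ : ℝ → ℝ}
  {f u : (Fin m → ℝ) → ℝ → ℝ}

theorem continuous_space (h : IsWeakSol T a β γ f u) {τ : ℝ} (hτ : τ ∈ Ico 0 T) :
    Continuous fun y => u y τ := by
  have : ContinuousOn (fun y : Fin m → ℝ => (y, τ)) univ := by fun_prop
  exact continuousOn_univ.1 (h.cont.comp this fun y _ => ⟨mem_univ _, hτ⟩)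

/-- Moving the shift from `ζ` onto `u` fixes the compact support of the integrand, so continuity
under the integral applies. -/
theorem continuousOn_mollify (h : IsWeakSol T a β γ f u) {ζ : (Fin m → ℝ) → ℝ} (hζ : IsTest ζ) :
    ContinuousOn (fun p : (Fin m → ℝ) × ℝ => ∫ w, u w p.2 * ζ (p.1 - w)) (univ ×ˢ Ico 0 T) := by
  have e : ∀ p : (Fin m → ℝ) × ℝ,
      ∫ w, u w p.2 * ζ (p.1 - w) = ∫ w, u (p.1 - w) p.2 * ζ w := by
    intro p
    rw [← integral_sub_left_eq_self (fun w => u w p.2 * ζ (p.1 - w)) volume p.1]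
    simp
  simp only [e]
  refine continuousOn_integral_of_compact_support
    (f := fun (p : (Fin m → ℝ) × ℝ) w => u (p.1 - w) p.2 * ζ w) hζ.compact ?_ ?_
  · refine ContinuousOn.mul ?_ (hζ.continuous.comp continuous_snd).continuousOn
    refine h.cont.comp (f := fun q : ((Fin m → ℝ) × ℝ) × (Fin m → ℝ) => (q.1.1 - q.2, q.1.2))
      (by fun_prop) fun q hq => ⟨mem_univ _, hq.1.2⟩
  · intro p w _ hw
    simp [image_eq_zero_of_notMem_tsupport hw]

theorem hasDerivAt_mollify (h : IsWeakSol T a β γ f u) {ζ : (Fin m → ℝ) → ℝ} (hζ : IsTest ζ)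
    (y : Fin m → ℝ) {τ : ℝ} (hτ : τ ∈ Ioo 0 T) :
    HasDerivAt (fun s => ∫ w, u w s * ζ (y - w))
      ((∫ w, u w τ * ellOp (fun i j => a i j τ) (fun i => β i τ) (γ τ) ζ (y - w))
        + ∫ w, f w τ * ζ (y - w)) τ := by
  have := h.weak _ (hζ.comp_sub_left y) τ hτ
  simpa only [ellOp_comp_sub_left hζ] using this

/-- The mass of `u` on balls is integrable in time, with a Gaussian bound in the centre. -/
theorem exists_integral_ball_le (h : IsWeakSol T a β γ f u) (R : ℝ) :
    ∃ k C : ℝ, 0 < k ∧ ∀ y : Fin m → ℝ,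
      IntegrableOn (fun s => ∫ w in Metric.closedBall y R, |u w s|) (Ioo 0 T) ∧
      ∫ s in Ioo 0 T, ∫ w in Metric.closedBall y R, |u w s| ≤ C * Real.exp (k * sqNorm y) := by
  obtain ⟨k, hk, hint⟩ := h.growth
  set g : (Fin m → ℝ) × ℝ → ℝ := fun p => u p.1 p.2 * Real.exp (-k * sqNorm p.1) with hg
  set I : ℝ := ∫ p in (univ : Set (Fin m → ℝ)) ×ˢ Ioo 0 T, |g p| with hI
  refine ⟨2 * k, Real.exp (2 * k * (m * R ^ 2)) * I, by positivity, fun y => ?_⟩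
  -- On the ball, `sqNorm w ≤ 2 * sqNorm y + 2 * m * R ^ 2`, so `c` compensates the Gaussian weight
  -- there; this is where the rate doubles.
  set c : ℝ := Real.exp (k * (2 * sqNorm y + 2 * (m * R ^ 2))) with hc
  have hB : MeasurableSet (Metric.closedBall y R) := Metric.isClosed_closedBall.measurableSet
  have hS : MeasurableSet (Metric.closedBall y R ×ˢ Ioo 0 T) := hB.prod measurableSet_Ioo
  have hsub : Metric.closedBall y R ×ˢ Ioo 0 T ⊆ (univ : Set (Fin m → ℝ)) ×ˢ Ioo 0 T :=
    prod_mono (subset_univ _) subset_rfl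
  have hgS : IntegrableOn (fun p => c * |g p|) (Metric.closedBall y R ×ˢ Ioo 0 T) :=
    ((hint.mono_set hsub).abs).const_mul c
  have hle : ∀ p ∈ Metric.closedBall y R ×ˢ Ioo 0 T, |u p.1 p.2| ≤ c * |g p| := by
    intro p hp
    have h1 : sqNorm p.1 ≤ 2 * sqNorm y + 2 * (m * R ^ 2) := by
      have h2 := sqNorm_add_le y (p.1 - y)
      have h3 := sqNorm_le_of_norm_le (y := p.1 - y) (R := R) (by simpa [dist_eq_norm] using hp.1)
      rw [add_sub_cancel] at h2
      linarith
    have h4 : (1 : ℝ) ≤ c * Real.exp (-k * sqNorm p.1) := by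
      rw [hc, ← Real.exp_add]
      refine Real.one_le_exp ?_
      nlinarith
    simp only [hg]
    rw [abs_mul, abs_of_pos (Real.exp_pos _)]
    nlinarith [abs_nonneg (u p.1 p.2)]
  have huS : IntegrableOn (fun p : (Fin m → ℝ) × ℝ => |u p.1 p.2|)
      (Metric.closedBall y R ×ˢ Ioo 0 T) := by
    refine Integrable.mono' hgS ?_ ?_
    · refine ContinuousOn.aestronglyMeasurable ?_ hS
      exact (h.cont.mono (prod_mono (subset_univ _) Ioo_subset_Ico_self)).abs
    · filter_upwards [ae_restrict_mem hS] with p hp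
      rw [Real.norm_eq_abs, abs_abs]
      exact hle p hp
  have hprod : (volume : Measure ((Fin m → ℝ) × ℝ)).restrict (Metric.closedBall y R ×ˢ Ioo 0 T) =
      (volume.restrict (Metric.closedBall y R)).prod (volume.restrict (Ioo 0 T)) := by
    rw [Measure.prod_restrict]; rfl
  have huS' := huS
  rw [IntegrableOn, hprod] at huS'
  refine ⟨huS'.integral_prod_right, ?_⟩
  calc ∫ s in Ioo 0 T, ∫ w in Metric.closedBall y R, |u w s|
      = ∫ p in Metric.closedBall y R ×ˢ Ioo 0 T, |u p.1 p.2| := by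
        rw [hprod, integral_prod_symm _ huS']
    _ ≤ ∫ p in Metric.closedBall y R ×ˢ Ioo 0 T, c * |g p| :=
        setIntegral_mono_on huS hgS hS hle
    _ = c * ∫ p in Metric.closedBall y R ×ˢ Ioo 0 T, |g p| := integral_const_mul _ _
    _ ≤ c * I := by
        refine mul_le_mul_of_nonneg_left ?_ (Real.exp_nonneg _)
        exact setIntegral_mono_set hint.abs (Eventually.of_forall fun p => abs_nonneg _)
          hsub.eventuallyLE
    _ = Real.exp (2 * k * (m * R ^ 2)) * I * Real.exp (2 * k * sqNorm y) := by
        rw [mul_right_comm, ← Real.exp_add, hc]; ring_nf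

/-- Mollifications of a supersolution with nonnegative initial values have a pointwise Gaussian
lower bound. -/
theorem exists_mollify_ge (h : IsWeakSol T a β γ f u) {M : ℝ}
    (ha : ∀ τ ∈ Ioo 0 T, ∀ i j, |a i j τ| ≤ M) (hβ : ∀ τ ∈ Ioo 0 T, ∀ i, |β i τ| ≤ M)
    (hγ : ∀ τ ∈ Ioo 0 T, |γ τ| ≤ M) (hf : ∀ τ ∈ Ioo 0 T, ∀ y, 0 ≤ f y τ)
    (hu0 : ∀ y, 0 ≤ u y 0) {ζ : (Fin m → ℝ) → ℝ} (hζ : IsTest ζ) (hζ0 : ∀ y, 0 ≤ ζ y) :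
    ∃ k C : ℝ, 0 < k ∧ ∀ y, ∀ τ ∈ Ico 0 T,
      -C * Real.exp (k * sqNorm y) ≤ ∫ w, u w τ * ζ (y - w) := by
  obtain ⟨K, R, hK, hbound⟩ := exists_ellOp_bound hζ M
  obtain ⟨k, C, hk, hC⟩ := h.exists_integral_ball_le R
  refine ⟨k, K * C, hk, fun y τ hτ => ?_⟩
  obtain ⟨hint, hle⟩ := hC y
  set N : ℝ → ℝ := fun s => ∫ w in Metric.closedBall y R, |u w s| with hN
  have hN0 : ∀ s, 0 ≤ N s := fun s => integral_nonneg fun w => abs_nonneg _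
  have hsub : Ioc 0 τ ⊆ Ioo 0 T := fun s hs => ⟨hs.1, hs.2.trans_lt hτ.2⟩
  have hcont : ContinuousOn (fun s => -∫ w, u w s * ζ (y - w)) (Icc 0 τ) := by
    refine ((h.continuousOn_mollify hζ).comp (f := fun s : ℝ => (y, s)) (by fun_prop) ?_).neg
    exact fun s hs => ⟨mem_univ _, hs.1, hs.2.trans_lt hτ.2⟩
  have hφ : IntegrableOn (fun s => K * N s) (Icc 0 τ) := by
    rw [integrableOn_Icc_iff_integrableOn_Ioc]
    exact (hint.mono_set hsub).const_mul K
  -- Integrate the derivative of minus the mollification. The nonnegative source can be dropped, and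
  -- the operator term is controlled by the mass on a ball, which is integrable in time.
  have key := intervalIntegral.sub_le_integral_of_hasDeriv_right_of_le hτ.1 hcont
    (fun s hs => (h.hasDerivAt_mollify hζ y
      (hsub ⟨hs.1, hs.2.le⟩)).neg.hasDerivWithinAt) hφ (fun s hs => by
      have hs' : s ∈ Ioo 0 T := hsub ⟨hs.1, hs.2.le⟩
      have h1 := abs_integral_mul_le_of_indicator_bound
        (h.continuous_space (Ioo_subset_Ico_self hs')) y
        (hbound (fun i j => a i j s) (fun i => β i s) (γ s) (ha s hs') (hβ s hs') (hγ s hs'))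
      have h2 : 0 ≤ ∫ w, f w s * ζ (y - w) :=
        integral_nonneg fun w => mul_nonneg (hf s hs' w) (hζ0 _)
      have h3 := neg_le_of_abs_le h1
      simp only [hN]
      linarith)
  have h0 : 0 ≤ ∫ w, u w 0 * ζ (y - w) :=
    integral_nonneg fun w => mul_nonneg (hu0 w) (hζ0 _)
  have h4 : ∫ s in (0 : ℝ)..τ, K * N s ≤ K * (C * Real.exp (k * sqNorm y)) := by
    rw [intervalIntegral.integral_of_le hτ.1, integral_const_mul]
    refine mul_le_mul_of_nonneg_left (le_trans ?_ hle) hK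
    exact setIntegral_mono_set hint (Eventually.of_forall hN0) hsub.eventuallyLE
  linarith

/-- Supersolutions of Gaussian growth with nonnegative initial values are nonnegative. -/
theorem nonneg (h : IsWeakSol T a β γ f u) {M : ℝ} (hM : 0 ≤ M)
    (hpsd : ∀ τ ∈ Ioo 0 T, ∀ ξ : Fin m → ℝ, 0 ≤ ∑ i, ∑ j, a i j τ * ξ i * ξ j)
    (ha : ∀ τ ∈ Ioo 0 T, ∀ i j, |a i j τ| ≤ M) (hβ : ∀ τ ∈ Ioo 0 T, ∀ i, |β i τ| ≤ M)
    (hγ : ∀ τ ∈ Ioo 0 T, |γ τ| ≤ M) (hf : ∀ τ ∈ Ioo 0 T, ∀ y, 0 ≤ f y τ)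
    (hu0 : ∀ y, 0 ≤ u y 0) : ∀ y, ∀ τ ∈ Ico 0 T, 0 ≤ u y τ := by
  have hmol : ∀ ζ : (Fin m → ℝ) → ℝ, IsTest ζ → (∀ y, 0 ≤ ζ y) →
      ∀ y, ∀ τ ∈ Ico 0 T, 0 ≤ ∫ w, u w τ * ζ (y - w) := by
    intro ζ hζ hζ0
    obtain ⟨k, C, hk, hlow⟩ := h.exists_mollify_ge ha hβ hγ hf hu0 hζ hζ0
    obtain ⟨δ, hδ, hstep⟩ := exists_short_time_nonneg m hM hk.le
    -- `δ` depends on `m`, `M` and `k` but not on `C`, and the lower bound `hlow` holds on the whole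
    -- interval, so steps of the same length reach every time below `T`.
    have hind : ∀ n : ℕ, ∀ y, ∀ τ ∈ Ico 0 T, τ ≤ n * δ → 0 ≤ ∫ w, u w τ * ζ (y - w) := by
      intro n
      induction n with
      | zero =>
        intro y τ hτ hτn
        have : τ = 0 := le_antisymm (by simpa using hτn) hτ.1
        subst this
        exact integral_nonneg fun w => mul_nonneg (hu0 w) (hζ0 _)
      | succ n ih =>
        intro y τ hτ hτn
        rcases le_total τ (n * δ) with hle | hle
        · exact ih y τ hτ hle
        have hn0 : (0 : ℝ) ≤ n * δ := by positivity
        have hsub : Ioc (n * δ) τ ⊆ Ioo 0 T := fun s hs => ⟨hn0.trans_lt hs.1, hs.2.trans_lt hτ.2⟩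
        have hsub' : Icc (n * δ) τ ⊆ Ico 0 T := fun s hs => ⟨hn0.trans hs.1, hs.2.trans_lt hτ.2⟩
        have hcs : ∀ s ∈ Ioc (n * δ) τ, Continuous fun y => u y s := fun s hs =>
          h.continuous_space (Ioo_subset_Ico_self (hsub hs))
        refine hstep (n * δ) τ C (by push_cast at hτn; linarith) a β γ
          (fun y s => ∫ w, u w s * ζ (y - w)) _
          (fun s hs => hpsd s (hsub hs)) (fun s hs => ha s (hsub hs))
          (fun s hs => hβ s (hsub hs)) (fun s hs => hγ s (hsub hs))
          ((h.continuousOn_mollify hζ).mono (prod_mono subset_rfl hsub'))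
          (fun s hs => contDiff_mollify (hcs s hs) hζ)
          (fun y s hs => h.hasDerivAt_mollify hζ y (hsub hs)) (fun y s hs => ?_)
          (fun y => ih y _ (hsub' ⟨le_rfl, hle⟩) le_rfl)
          (fun y s hs => hlow y s (hsub' hs)) y τ ⟨hle, le_rfl⟩
        rw [ellOp_mollify (hcs s hs) hζ]
        exact le_add_of_nonneg_right
          (integral_nonneg fun w => mul_nonneg (hf s (hsub hs) w) (hζ0 _))
    intro y τ hτ
    obtain ⟨n, hn⟩ := exists_nat_ge (τ / δ)
    exact hind n y τ hτ ((div_le_iff₀ hδ).1 hn)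
  intro y τ hτ
  by_contra! hneg
  have hc := h.continuous_space hτ
  obtain ⟨ζ, hsupp, hcomp, hsm, hrange, hy⟩ := exists_contDiff_tsupport_subset (n := ⊤)
    ((isOpen_lt hc continuous_const).mem_nhds hneg)
  have hζ0 : ∀ w, 0 ≤ ζ w := fun w => (hrange ⟨w, rfl⟩).1
  have hζ : IsTest ζ := ⟨hsm, hcomp⟩
  -- Mollifying at `0` with the reflected bump gives the integral of `u` against `ζ`, whose support
  -- lies where `u` is negative.
  have h1 := hmol (fun w => ζ (0 - w)) (hζ.comp_sub_left 0) (fun w => hζ0 _) 0 τ hτ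
  simp only [zero_sub, neg_neg] at h1
  have h2 : 0 < ∫ w, -(u w τ * ζ w) := by
    refine (hc.mul hζ.continuous).neg.integral_pos_of_hasCompactSupport_nonneg_nonzero
      (hcomp.mul_left (f := fun w => u w τ)).neg (fun w => ?_) (x := y) ?_
    · by_cases hw : w ∈ tsupport ζ
      · have : u w τ < 0 := hsupp hw
        simp only [Pi.zero_apply]
        nlinarith [hζ0 w]
      · simp [image_eq_zero_of_notMem_tsupport hw]
    · rw [hy]; simpa using hneg.ne
  rw [integral_neg] at h2
  linarith

end IsWeakSol

/-! ### Linear combinations and translates of weak solutions -/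

theorem IntegrableOn.gaussian_mono {m : ℕ} {g : (Fin m → ℝ) × ℝ → ℝ} {k k' : ℝ}
    {S : Set ((Fin m → ℝ) × ℝ)} (hkk' : k ≤ k')
    (h : IntegrableOn (fun p => g p * Real.exp (-k * sqNorm p.1)) S) :
    IntegrableOn (fun p => g p * Real.exp (-k' * sqNorm p.1)) S := by
  have hc : Continuous fun p : (Fin m → ℝ) × ℝ => Real.exp (-(k' - k) * sqNorm p.1) := by
    have := (contDiff_sqNorm (m := m) (n := 0)).continuous
    fun_prop
  have e : (fun p : (Fin m → ℝ) × ℝ => g p * Real.exp (-k' * sqNorm p.1)) =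
      fun p => g p * Real.exp (-k * sqNorm p.1) * Real.exp (-(k' - k) * sqNorm p.1) := by
    ext p
    rw [mul_assoc, ← Real.exp_add]; ring_nf
  rw [e]
  refine Integrable.mono h (h.aestronglyMeasurable.mul hc.aestronglyMeasurable)
    (Eventually.of_forall fun p => ?_)
  rw [norm_mul]
  refine mul_le_of_le_one_right (norm_nonneg _) ?_
  rw [Real.norm_eq_abs, abs_of_pos (Real.exp_pos _), Real.exp_le_one_iff]
  nlinarith [sqNorm_nonneg p.1]

namespace IsWeakSol

variable {m : ℕ} {T : ℝ} {a : Fin m → Fin m → ℝ → ℝ} {β : Fin m → ℝ → ℝ} {γ : ℝ → ℝ}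
  {f u f' u' : (Fin m → ℝ) → ℝ → ℝ}

theorem add (h : IsWeakSol T a β γ f u) (h' : IsWeakSol T a β γ f' u') :
    IsWeakSol T a β γ (fun y τ => f y τ + f' y τ) (fun y τ => u y τ + u' y τ) where
  cont := h.cont.add h'.cont
  cont_source τ hτ := (h.cont_source τ hτ).add (h'.cont_source τ hτ)
  weak ζ hζ τ hτ := by
    have hL := hζ.ellOp (fun i j => a i j τ) (fun i => -β i τ) (γ τ)
    have hτ' := Ioo_subset_Ico_self hτ
    simp only [add_mul]
    rw [integral_add (hL.integrable_mul (h.continuous_space hτ'))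
      (hL.integrable_mul (h'.continuous_space hτ')),
      integral_add (hζ.integrable_mul (h.cont_source τ hτ))
      (hζ.integrable_mul (h'.cont_source τ hτ)), add_add_add_comm]
    refine ((h.weak ζ hζ τ hτ).fun_add (h'.weak ζ hζ τ hτ)).congr_of_eventuallyEq ?_
    filter_upwards [isOpen_Ioo.mem_nhds hτ] with s hs
    exact integral_add (hζ.integrable_mul (h.continuous_space (Ioo_subset_Ico_self hs)))
      (hζ.integrable_mul (h'.continuous_space (Ioo_subset_Ico_self hs)))
  growth := by
    obtain ⟨k, hk, hi⟩ := h.growth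
    obtain ⟨k', hk', hi'⟩ := h'.growth
    refine ⟨max k k', lt_max_of_lt_left hk, ?_⟩
    simp only [add_mul]
    exact (IntegrableOn.gaussian_mono (le_max_left k k') hi).add
      (IntegrableOn.gaussian_mono (le_max_right k k') hi')

theorem const_mul (h : IsWeakSol T a β γ f u) (c : ℝ) :
    IsWeakSol T a β γ (fun y τ => c * f y τ) (fun y τ => c * u y τ) where
  cont := continuousOn_const.mul h.cont
  cont_source τ hτ := continuous_const.mul (h.cont_source τ hτ)
  weak ζ hζ τ hτ := by
    simp only [mul_assoc, integral_const_mul, ← mul_add]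
    exact (h.weak ζ hζ τ hτ).const_mul c
  growth := by
    obtain ⟨k, hk, hi⟩ := h.growth
    refine ⟨k, hk, ?_⟩
    simp only [mul_assoc]
    exact hi.const_mul c

theorem translate (h : IsWeakSol T a β γ f u) (p : Fin m → ℝ) :
    IsWeakSol T a β γ (fun y τ => f (y + p) τ) (fun y τ => u (y + p) τ) where
  cont := h.cont.comp (f := fun q : (Fin m → ℝ) × ℝ => (q.1 + p, q.2)) (by fun_prop)
    fun q hq => ⟨mem_univ _, hq.2⟩
  cont_source τ hτ := (h.cont_source τ hτ).comp (continuous_id.add continuous_const)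
  weak ζ hζ τ hτ := by
    have e : ∀ g ψ : (Fin m → ℝ) → ℝ, ∫ w, g (w + p) * ψ w = ∫ w, g w * ψ (w - p) := by
      intro g ψ
      rw [← integral_add_right_eq_self (fun w => g w * ψ (w - p)) p]
      simp
    have := h.weak _ (hζ.comp_sub_right p) τ hτ
    simp only [ellOp_comp_sub_right] at this
    have e' : (fun s => ∫ w, u (w + p) s * ζ w) = fun s => ∫ w, u w s * ζ (w - p) :=
      funext fun s => e (fun w => u w s) ζ
    rw [e', e (fun w => f w τ), e (fun w => u w τ)]
    exact this
  growth := by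
    obtain ⟨k, hk, hi⟩ := h.growth
    -- Doubling the rate absorbs the translation, by `sqNorm (q + p) ≤ 2 * sqNorm q + 2 * sqNorm p`.
    refine ⟨2 * k, by positivity, ?_⟩
    have : (volume : Measure ((Fin m → ℝ) × ℝ)).IsAddRightInvariant := by
      rw [Measure.volume_eq_prod]; infer_instance
    have hmp := measurePreserving_add_right (volume : Measure ((Fin m → ℝ) × ℝ)) (p, 0)
    have h1 := (hmp.integrableOn_comp_preimage
      (Homeomorph.addRight ((p, 0) : (Fin m → ℝ) × ℝ)).measurableEmbedding).2 hi
    have e : (fun x : (Fin m → ℝ) × ℝ => x + (p, 0)) ⁻¹' ((univ : Set (Fin m → ℝ)) ×ˢ Ioo 0 T) =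
        univ ×ˢ Ioo 0 T := by
      ext x; simp
    rw [e] at h1
    have hc : Continuous fun q : (Fin m → ℝ) × ℝ =>
        Real.exp (-(2 * k) * sqNorm q.1 + k * sqNorm (q.1 + p)) := by
      have := (contDiff_sqNorm (m := m) (n := 0)).continuous
      fun_prop
    refine Integrable.mono' (h1.abs.const_mul (Real.exp (2 * k * sqNorm p)))
      (f := fun q : (Fin m → ℝ) × ℝ => u (q.1 + p) q.2 * Real.exp (-(2 * k) * sqNorm q.1)) ?_ ?_
    · refine (h1.aestronglyMeasurable.mul hc.aestronglyMeasurable).congr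
        (Eventually.of_forall fun q => ?_)
      simp only [Function.comp, Pi.mul_apply, Prod.fst_add, Prod.snd_add, add_zero]
      rw [mul_assoc, ← Real.exp_add]; ring_nf
    · refine Eventually.of_forall fun q => ?_
      simp only [Function.comp, Prod.fst_add, Prod.snd_add, add_zero]
      rw [Real.norm_eq_abs, abs_mul, abs_mul, abs_of_pos (Real.exp_pos _),
        abs_of_pos (Real.exp_pos _), mul_left_comm, ← Real.exp_add]
      gcongr
      nlinarith [sqNorm_add_le q.1 p]

end IsWeakSol

/-! ### From classical to weak solutions -/

theorem hasDerivAt_integral_mul_test {m : ℕ} {I : Set ℝ} (hI : IsOpen I)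
    {u u' : (Fin m → ℝ) → ℝ → ℝ}
    (hu : ContinuousOn (fun p : (Fin m → ℝ) × ℝ => u p.1 p.2) (univ ×ˢ I))
    (hu' : ContinuousOn (fun p : (Fin m → ℝ) × ℝ => u' p.1 p.2) (univ ×ˢ I))
    (hd : ∀ y, ∀ s ∈ I, HasDerivAt (fun s => u y s) (u' y s) s)
    {ζ : (Fin m → ℝ) → ℝ} (hζ : IsTest ζ) {τ : ℝ} (hτ : τ ∈ I) :
    HasDerivAt (fun s => ∫ w, u w s * ζ w) (∫ w, u' w τ * ζ w) τ := by
  have hslice : ∀ {g : (Fin m → ℝ) → ℝ → ℝ},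
      ContinuousOn (fun p : (Fin m → ℝ) × ℝ => g p.1 p.2) (univ ×ˢ I) →
      ∀ s ∈ I, Continuous fun y => g y s := fun hg s hs =>
    continuousOn_univ.1 (hg.comp (f := fun y => (y, s)) (by fun_prop)
      fun y _ => ⟨mem_univ _, hs⟩)
  obtain ⟨ε, hε, hball⟩ := Metric.nhds_basis_closedBall.mem_iff.1 (hI.mem_nhds hτ)
  have hK : IsCompact (tsupport ζ ×ˢ Metric.closedBall τ ε) :=
    hζ.compact.isCompact.prod (isCompact_closedBall _ _)
  obtain ⟨K, hKb⟩ := hK.exists_bound_of_continuousOn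
    (f := fun p : (Fin m → ℝ) × ℝ => u' p.1 p.2 * ζ p.1)
    ((hu'.mono (prod_mono (subset_univ _) hball)).mul
      (hζ.continuous.comp continuous_fst).continuousOn)
  have hts : MeasurableSet (tsupport ζ) := (isClosed_tsupport ζ).measurableSet
  refine (hasDerivAt_integral_of_dominated_loc_of_deriv_le
    (F := fun s w => u w s * ζ w) (F' := fun s w => u' w s * ζ w)
    (bound := (tsupport ζ).indicator fun _ => K) (Metric.closedBall_mem_nhds τ hε)
    ?_ ?_ ?_ ?_ ?_ ?_).2
  · filter_upwards [hI.mem_nhds hτ] with s hs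
    exact ((hslice hu s hs).mul hζ.continuous).aestronglyMeasurable
  · exact hζ.integrable_mul (hslice hu τ hτ)
  · exact ((hslice hu' τ hτ).mul hζ.continuous).aestronglyMeasurable
  · refine Eventually.of_forall fun w s hs => ?_
    by_cases hw : w ∈ tsupport ζ
    · rw [indicator_of_mem hw]; exact hKb (w, s) ⟨hw, hs⟩
    · rw [indicator_of_notMem hw, image_eq_zero_of_notMem_tsupport hw]; simp
  · rw [integrable_indicator_iff hts]
    exact integrableOn_const hζ.compact.isCompact.measure_ne_top
  · exact Eventually.of_forall fun w s hs => (hd w s (hball hs)).mul_const _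

theorem integral_lineDeriv_mul_test {m : ℕ} {u u' : (Fin m → ℝ) → ℝ} (hu : Continuous u)
    (hu' : Continuous u') {v : Fin m → ℝ} (hd : ∀ y, HasLineDerivAt ℝ u (u' y) y v)
    {ζ : (Fin m → ℝ) → ℝ} (hζ : IsTest ζ) :
    ∫ w, u' w * ζ w = -∫ w, u w * dirDeriv v ζ w := by
  have h := integral_bilinear_hasLineDerivAt_right_eq_neg_left_of_integrable (μ := volume)
    (f := ζ) (f' := dirDeriv v ζ) (g := u) (g' := u') (v := v)
    (B := ContinuousLinearMap.mul ℝ ℝ)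
    (by simpa [mul_comm] using (hζ.dirDeriv v).integrable_mul hu)
    (by simpa [mul_comm] using hζ.integrable_mul hu')
    (by simpa [mul_comm] using hζ.integrable_mul hu)
    (fun w _ => (hζ.differentiable w).hasFDerivAt.hasLineDerivAt v) (fun w _ => hd w)
  simpa [mul_comm] using h

/-- A solution with continuous derivatives is a weak solution. -/
theorem isWeakSol_of_strong {m : ℕ} {T : ℝ} {a : Fin m → Fin m → ℝ → ℝ} {β : Fin m → ℝ → ℝ}
    {γ : ℝ → ℝ} {f u u' : (Fin m → ℝ) → ℝ → ℝ} {D₁ : Fin m → (Fin m → ℝ) → ℝ → ℝ}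
    {D₂ : Fin m → Fin m → (Fin m → ℝ) → ℝ → ℝ}
    (hu : ContinuousOn (fun p : (Fin m → ℝ) × ℝ => u p.1 p.2) (univ ×ˢ Ico 0 T))
    (hu' : ContinuousOn (fun p : (Fin m → ℝ) × ℝ => u' p.1 p.2) (univ ×ˢ Ioo 0 T))
    (hf : ∀ τ ∈ Ioo 0 T, Continuous fun y => f y τ)
    (hD₁ : ∀ i, ∀ τ ∈ Ioo 0 T, Continuous fun y => D₁ i y τ)
    (hD₂ : ∀ i j, ∀ τ ∈ Ioo 0 T, Continuous fun y => D₂ i j y τ)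
    (hd : ∀ y, ∀ τ ∈ Ioo 0 T, HasDerivAt (fun s => u y s) (u' y τ) τ)
    (hl₁ : ∀ i y, ∀ τ ∈ Ioo 0 T, HasLineDerivAt ℝ (fun y => u y τ) (D₁ i y τ) y (coordVec i))
    (hl₂ : ∀ i j y, ∀ τ ∈ Ioo 0 T,
      HasLineDerivAt ℝ (fun y => D₁ j y τ) (D₂ i j y τ) y (coordVec i))
    (heq : ∀ y, ∀ τ ∈ Ioo 0 T, u' y τ = (1 / 2 : ℝ) * ∑ i, ∑ j, a i j τ * D₂ i j y τ
      + ∑ i, β i τ * D₁ i y τ + γ τ * u y τ + f y τ)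
    (hgrowth : ∃ k : ℝ, 0 < k ∧ IntegrableOn
      (fun p : (Fin m → ℝ) × ℝ => u p.1 p.2 * Real.exp (-k * sqNorm p.1)) (univ ×ˢ Ioo 0 T)) :
    IsWeakSol T a β γ f u where
  cont := hu
  cont_source := hf
  growth := hgrowth
  weak ζ hζ τ hτ := by
    have hut : Continuous fun y => u y τ := continuousOn_univ.1
      (hu.comp (f := fun y => (y, τ)) (by fun_prop)
        fun y _ => ⟨mem_univ _, Ioo_subset_Ico_self hτ⟩)
    have h := hasDerivAt_integral_mul_test isOpen_Ioo
      (hu.mono (prod_mono subset_rfl Ioo_subset_Ico_self)) hu' hd hζ hτ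
    convert h using 1
    have e : ∀ w, u' w τ * ζ w = (1 / 2 : ℝ) * ∑ i, ∑ j, a i j τ * (D₂ i j w τ * ζ w)
        + ∑ i, β i τ * (D₁ i w τ * ζ w) + γ τ * (u w τ * ζ w) + f w τ * ζ w := by
      intro w
      rw [heq w τ hτ]
      simp only [add_mul, Finset.sum_mul, mul_assoc]
    have i2 : ∀ i j, Integrable fun w => a i j τ * (D₂ i j w τ * ζ w) := fun i j =>
      (hζ.integrable_mul (hD₂ i j τ hτ)).const_mul _
    have i2' : ∀ i, Integrable fun w => ∑ j, a i j τ * (D₂ i j w τ * ζ w) := fun i =>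
      integrable_finsetSum _ fun j _ => i2 i j
    have i1 : ∀ i, Integrable fun w => β i τ * (D₁ i w τ * ζ w) := fun i =>
      (hζ.integrable_mul (hD₁ i τ hτ)).const_mul _
    have I2 := (integrable_finsetSum Finset.univ fun i _ => i2' i).const_mul (1 / 2 : ℝ)
    have I1 := integrable_finsetSum Finset.univ fun i _ => i1 i
    have I0 := (hζ.integrable_mul hut).const_mul (γ τ)
    simp only [e]
    rw [integral_add ((I2.fun_add I1).fun_add I0) (hζ.integrable_mul (hf τ hτ)),
      integral_add (I2.fun_add I1) I0, integral_add I2 I1, integral_const_mul, integral_const_mul,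
      integral_finsetSum _ fun i _ => i2' i, integral_finsetSum _ fun i _ => i1 i,
      integral_mul_ellOp hut hζ]
    simp only [integral_finsetSum _ fun j _ => i2 _ j, integral_const_mul]
    have p1 : ∀ i, ∫ w, D₁ i w τ * ζ w = -∫ w, u w τ * dirDeriv (coordVec i) ζ w := fun i =>
      integral_lineDeriv_mul_test hut (hD₁ i τ hτ) (fun y => hl₁ i y τ hτ) hζ
    -- Two integrations by parts reverse the order of the derivatives on `ζ`; symmetry of its second
    -- derivative restores it.
    have p2 : ∀ i j, ∫ w, D₂ i j w τ * ζ w =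
        ∫ w, u w τ * dirDeriv (coordVec i) (dirDeriv (coordVec j) ζ) w := fun i j => by
      rw [integral_lineDeriv_mul_test (hD₁ j τ hτ) (hD₂ i j τ hτ) (fun y => hl₂ i j y τ hτ) hζ,
        integral_lineDeriv_mul_test hut (hD₁ j τ hτ) (fun y => hl₁ j y τ hτ)
          (hζ.dirDeriv (coordVec i)), neg_neg]
      simp only [dirDeriv_comm hζ.contDiff_two (coordVec i)]
    simp only [p1, p2, mul_neg, neg_mul]

/-! ### Logarithmic coordinates -/

/-- The coordinatewise exponential. -/
noncomputable def expVec {m : ℕ} (y : Fin m → ℝ) : Fin m → ℝ := fun i => Real.exp (y i)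

/-- The coordinatewise logarithm. -/
noncomputable def logVec {m : ℕ} (x : Fin m → ℝ) : Fin m → ℝ := fun i => Real.log (x i)

theorem expVec_mem {m : ℕ} (y : Fin m → ℝ) : expVec y ∈ posOrthant m := fun _ => Real.exp_pos _

theorem continuous_expVec {m : ℕ} : Continuous (expVec : (Fin m → ℝ) → Fin m → ℝ) := by
  unfold expVec; fun_prop

theorem expVec_add_logVec {m : ℕ} {x : Fin m → ℝ} (hx : x ∈ posOrthant m) (y : Fin m → ℝ) :
    expVec (y + logVec x) = fun i => Real.exp (y i) * x i := by
  ext i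
  simp only [expVec, logVec, Pi.add_apply]
  rw [Real.exp_add, Real.exp_log (hx i)]

theorem expVec_logVec {m : ℕ} {x : Fin m → ℝ} (hx : x ∈ posOrthant m) :
    expVec (logVec x) = x := by
  ext i; exact Real.exp_log (hx i)

theorem logTransform_eq {m : ℕ} {A : Type*} (t₁ : ℝ) (V : (Fin m → ℝ) × A → ℝ → ℝ)
    (y : Fin m → ℝ) (z : A) (τ : ℝ) : logTransform t₁ V y z τ = V (expVec y, z) (t₁ - τ) := rfl

/-- Along a coordinate direction `expVec` stays on a coordinate line, so the one-variable chain rule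
suffices and no Fréchet derivative of `f` is needed. -/
theorem hasLineDerivAt_comp_expVec {m : ℕ} {f : (Fin m → ℝ) → ℝ} {y : Fin m → ℝ} {i : Fin m}
    (hf : LineDifferentiableAt ℝ f (expVec y) (Pi.single i 1)) :
    HasLineDerivAt ℝ (fun y => f (expVec y)) (Real.exp (y i) * partialDeriv i f (expVec y)) y
      (coordVec i) := by
  have h1 : HasDerivAt (fun s : ℝ => f (expVec y + s • (Pi.single i 1 : Fin m → ℝ)))
      (partialDeriv i f (expVec y)) (Real.exp (y i + 0) - Real.exp (y i)) := by
    rw [add_zero, sub_self]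
    exact hf.hasLineDerivAt
  have h2 : HasDerivAt (fun s : ℝ => Real.exp (y i + s) - Real.exp (y i)) (Real.exp (y i)) 0 := by
    simpa using (((hasDerivAt_id (0 : ℝ)).const_add (y i)).exp).sub_const (Real.exp (y i))
  have h3 := h1.comp (0 : ℝ) h2
  rw [mul_comm] at h3
  refine h3.congr_of_eventuallyEq (Eventually.of_forall fun s => ?_)
  simp only [Function.comp]
  congr 1
  ext j
  by_cases hj : j = i
  · subst hj; simp [expVec]
  · simp [expVec, hj]

/-- In logarithmic coordinates a classical solution solves, for each value of the parameter, a
parabolic equation whose coefficients depend on time only. -/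
theorem IsClassicalSolution.isWeakSol {m : ℕ} {A : Type*} {Ω₂ : Set A} {t₀ t₁ : ℝ}
    {a : Fin m → Fin m → ℝ → ℝ} {b : Fin m → ℝ → ℝ} {c : ℝ → ℝ}
    {ω : (Fin m → ℝ) × A → ℝ → ℝ} {φ : (Fin m → ℝ) × A → ℝ} {V : (Fin m → ℝ) × A → ℝ → ℝ}
    (hV : IsClassicalSolution Ω₂ t₀ t₁ a b c ω φ V) (hgrowth : GaussianGrowth Ω₂ t₀ t₁ V)
    {z : A} (hz : z ∈ Ω₂)
    (hω : ContinuousOn (fun p : (Fin m → ℝ) × ℝ => ω (p.1, z) p.2)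
      (posOrthant m ×ˢ Icc t₀ t₁)) :
    IsWeakSol (t₁ - t₀) (fun i j τ => a i j (t₁ - τ))
      (fun i τ => b i (t₁ - τ) - 1 / 2 * a i i (t₁ - τ)) (fun τ => c (t₁ - τ))
      (fun y τ => ω (expVec y, z) (t₁ - τ)) (fun y τ => logTransform t₁ V y z τ) := by
  have hreg := hV.regular z hz
  have hIoo : ∀ τ ∈ Ioo 0 (t₁ - t₀), t₁ - τ ∈ Ioo t₀ t₁ := fun τ hτ =>
    ⟨by linarith [hτ.2], by linarith [hτ.1]⟩
  have hpair : ∀ {g : (Fin m → ℝ) → ℝ → ℝ},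
      ContinuousOn (fun p : (Fin m → ℝ) × ℝ => g p.1 p.2) (posOrthant m ×ˢ Ioo t₀ t₁) →
      ∀ τ ∈ Ioo 0 (t₁ - t₀), Continuous fun y => g (expVec y) (t₁ - τ) := fun hg τ hτ =>
    continuousOn_univ.1 (hg.comp (f := fun y => (expVec y, t₁ - τ))
      (continuous_expVec.prodMk continuous_const).continuousOn
      fun y _ => ⟨expVec_mem y, hIoo τ hτ⟩)
  have hexp : ∀ i : Fin m, Continuous fun y : Fin m → ℝ => Real.exp (y i) := fun i => by fun_prop
  have hmap : Continuous fun p : (Fin m → ℝ) × ℝ => (expVec p.1, t₁ - p.2) :=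
    (continuous_expVec.comp continuous_fst).prodMk (continuous_const.sub continuous_snd)
  refine isWeakSol_of_strong
    (u' := fun y τ => -deriv (fun s => V (expVec y, z) s) (t₁ - τ))
    (D₁ := fun i y τ => Real.exp (y i) *
      partialDeriv i (fun w => V (w, z) (t₁ - τ)) (expVec y))
    (D₂ := fun i j y τ => (if i = j then 1 else 0) * Real.exp (y j) *
        partialDeriv j (fun w => V (w, z) (t₁ - τ)) (expVec y) +
      Real.exp (y j) * (Real.exp (y i) *
        partialDeriv i (fun x => partialDeriv j (fun w => V (w, z) (t₁ - τ)) x) (expVec y)))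
    ?_ ?_ ?_ ?_ ?_ ?_ ?_ ?_ ?_ ?_
  · exact (hV.continuous z hz).comp hmap.continuousOn fun p hp =>
      ⟨expVec_mem _, by have := hp.2.2; simp only; linarith,
        by have := hp.2.1; simp only; linarith⟩
  · exact (hreg.continuous_t.comp hmap.continuousOn fun p hp =>
      ⟨expVec_mem _, hIoo _ hp.2⟩).neg
  · exact hpair (g := fun x t => ω (x, z) t) (hω.mono (prod_mono subset_rfl Ioo_subset_Icc_self))
  · exact fun i τ hτ => (hexp i).mul
      (hpair (g := fun x t => partialDeriv i (fun w => V (w, z) t) x) (hreg.continuous_x i) τ hτ)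
  · exact fun i j τ hτ => ((continuous_const.mul (hexp j)).mul
      (hpair (g := fun x t => partialDeriv j (fun w => V (w, z) t) x) (hreg.continuous_x j) τ hτ)).add
      ((hexp j).mul ((hexp i).mul
      (hpair (g := fun x t => partialDeriv i (fun y => partialDeriv j (fun w => V (w, z) t) y) x)
        (hreg.continuous_xx i j) τ hτ)))
  · intro y τ hτ
    have h1 := (hreg.differentiable_t _ (expVec_mem y) _ (hIoo τ hτ)).hasDerivAt
    exact h1.comp_const_sub t₁ τ
  · exact fun i y τ hτ => hasLineDerivAt_comp_expVec
      (hreg.differentiable_x _ (expVec_mem y) _ (hIoo τ hτ) i)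
  · intro i j y τ hτ
    have h1 := hasLineDerivAt_comp_expVec
      (hreg.differentiable_xx _ (expVec_mem y) _ (hIoo τ hτ) i j)
    have h2 : HasLineDerivAt ℝ (fun y : Fin m → ℝ => Real.exp (y j))
        ((if i = j then 1 else 0) * Real.exp (y j)) y (coordVec i) := by
      have h3 : HasDerivAt (fun s : ℝ => y j + s * (coordVec i : Fin m → ℝ) j)
          (1 * (coordVec i : Fin m → ℝ) j) 0 :=
        ((hasDerivAt_id (0 : ℝ)).mul_const _).const_add (y j)
      have h4 := h3.exp
      simp only [Pi.single_apply, zero_mul, add_zero, one_mul, eq_comm (a := j)] at h4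
      unfold HasLineDerivAt
      rw [mul_comm]
      simpa [Pi.single_apply, eq_comm (a := j)] using h4
    unfold HasLineDerivAt at h1 h2 ⊢
    simpa using h2.fun_mul h1
  · intro y τ hτ
    have h := hV.equation _ (expVec_mem y) z hz _ (hIoo τ hτ)
    have h' : -deriv (fun s => V (expVec y, z) s) (t₁ - τ) =
        gbmOperator a b c (t₁ - τ) (fun y => V (y, z) (t₁ - τ)) (expVec y)
          + ω (expVec y, z) (t₁ - τ) := by linarith
    rw [h', logTransform_eq]
    congr 1
    unfold gbmOperator
    congr 1
    -- Differentiating the factor `exp (y j)` produces an extra first-order term on the diagonal;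
    -- the correction `-1/2 * a i i` in the drift cancels it.
    have e : ∀ i : Fin m, ∑ j, a i j (t₁ - τ) * ((if i = j then 1 else 0) * Real.exp (y j) *
          partialDeriv j (fun w => V (w, z) (t₁ - τ)) (expVec y) +
        Real.exp (y j) * (Real.exp (y i) *
          partialDeriv i (fun x => partialDeriv j (fun w => V (w, z) (t₁ - τ)) x) (expVec y))) =
        a i i (t₁ - τ) * (Real.exp (y i) *
          partialDeriv i (fun w => V (w, z) (t₁ - τ)) (expVec y)) +
        ∑ j, a i j (t₁ - τ) * expVec y i * expVec y j *
          partialDeriv i (fun x => partialDeriv j (fun w => V (w, z) (t₁ - τ)) x) (expVec y) := by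
      intro i
      simp only [mul_add, Finset.sum_add_distrib]
      congr 1
      · simp
      · exact Finset.sum_congr rfl fun j _ => by simp only [expVec]; ring
    simp only [e]
    simp only [Finset.sum_add_distrib, mul_add, sub_mul, Finset.sum_sub_distrib,
      Finset.mul_sum]
    simp only [expVec, mul_assoc]
    ring
  · exact hgrowth z hz

theorem exists_bound_of_continuousOn_Icc {ι : Type*} [Fintype ι] {t₀ t₁ : ℝ} {h : ι → ℝ → ℝ}
    (hh : ∀ i, ContinuousOn (h i) (Icc t₀ t₁)) :
    ∃ M : ℝ, 0 ≤ M ∧ ∀ i, ∀ t ∈ Icc t₀ t₁, |h i t| ≤ M := by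
  choose K hK using fun i => isCompact_Icc.exists_bound_of_continuousOn (hh i)
  refine ⟨∑ i, |K i|, Finset.sum_nonneg fun i _ => abs_nonneg _, fun i t ht => ?_⟩
  exact ((hK i t ht).trans (le_abs_self _)).trans
    (Finset.single_le_sum (f := fun i => |K i|) (fun i _ => abs_nonneg _) (Finset.mem_univ i))

/-- The minimum principle for the equation in logarithmic coordinates. -/
theorem nonneg_of_isWeakSol_log {m : ℕ} {t₀ t₁ : ℝ}
    {a : Fin m → Fin m → ℝ → ℝ} {b : Fin m → ℝ → ℝ} {c : ℝ → ℝ}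
    (ha : ∀ i j, ContinuousOn (a i j) (Icc t₀ t₁)) (hb : ∀ i, ContinuousOn (b i) (Icc t₀ t₁))
    (hc : ContinuousOn c (Icc t₀ t₁)) (hell : IsUniformlyElliptic a (Icc t₀ t₁))
    {f u : (Fin m → ℝ) → ℝ → ℝ}
    (h : IsWeakSol (t₁ - t₀) (fun i j τ => a i j (t₁ - τ))
      (fun i τ => b i (t₁ - τ) - 1 / 2 * a i i (t₁ - τ)) (fun τ => c (t₁ - τ)) f u)
    (hf : ∀ τ ∈ Ioo 0 (t₁ - t₀), ∀ y, 0 ≤ f y τ) (hu0 : ∀ y, 0 ≤ u y 0) :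
    ∀ y, ∀ τ ∈ Ico 0 (t₁ - t₀), 0 ≤ u y τ := by
  obtain ⟨M₂, hM₂, h₂⟩ := exists_bound_of_continuousOn_Icc
    (h := fun (p : Fin m × Fin m) t => a p.1 p.2 t) fun p => ha p.1 p.2
  obtain ⟨M₁, hM₁, h₁⟩ := exists_bound_of_continuousOn_Icc
    (h := fun i t => b i t - 1 / 2 * a i i t)
    fun i => (hb i).sub (continuousOn_const.mul (ha i i))
  obtain ⟨M₀, hM₀, h₀⟩ := exists_bound_of_continuousOn_Icc (ι := Unit) (h := fun _ => c)
    fun _ => hc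
  have hI : ∀ τ ∈ Ioo 0 (t₁ - t₀), t₁ - τ ∈ Icc t₀ t₁ := fun τ hτ =>
    ⟨by linarith [hτ.2], by linarith [hτ.1]⟩
  obtain ⟨lam, hlam, hell⟩ := hell
  refine h.nonneg (M := M₂ + M₁ + M₀) (by positivity) (fun τ hτ ξ => ?_)
    (fun τ hτ i j => (h₂ (i, j) _ (hI τ hτ)).trans (by linarith))
    (fun τ hτ i => (h₁ i _ (hI τ hτ)).trans (by linarith))
    (fun τ hτ => (h₀ () _ (hI τ hτ)).trans (by linarith)) hf hu0
  exact (mul_nonneg hlam.le (Finset.sum_nonneg fun i _ => sq_nonneg _)).trans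
    (hell _ (hI τ hτ) ξ)

/-- The terminal condition is only a left limit; continuity up to `t₁` identifies it with the value,
which is the initial value after time reversal. -/
theorem IsClassicalSolution.eq_terminal {m : ℕ} {A : Type*} {Ω₂ : Set A} {t₀ t₁ : ℝ}
    (ht : t₀ < t₁) {a : Fin m → Fin m → ℝ → ℝ} {b : Fin m → ℝ → ℝ} {c : ℝ → ℝ}
    {ω : (Fin m → ℝ) × A → ℝ → ℝ} {φ : (Fin m → ℝ) × A → ℝ} {V : (Fin m → ℝ) × A → ℝ → ℝ}
    (hV : IsClassicalSolution Ω₂ t₀ t₁ a b c ω φ V) {x : Fin m → ℝ} (hx : x ∈ posOrthant m)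
    {z : A} (hz : z ∈ Ω₂) : V (x, z) t₁ = φ (x, z) := by
  have h1 : ContinuousOn (fun t => V (x, z) t) (Ioc t₀ t₁) :=
    (hV.continuous z hz).comp (f := fun t : ℝ => (x, t)) (by fun_prop) fun t ht => ⟨hx, ht⟩
  have h2 : Tendsto (fun t => V (x, z) t) (𝓝[<] t₁) (𝓝 (V (x, z) t₁)) := by
    refine (h1 t₁ ⟨ht, le_rfl⟩).mono_left ?_
    rw [← nhdsWithin_Ioo_eq_nhdsLT ht]
    exact nhdsWithin_mono _ Ioo_subset_Ioc_self
  exact tendsto_nhds_unique h2 (hV.terminal x hx z hz)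

/-! ### Preservation of convexity and monotonicity -/

section Preservation

variable {m : ℕ} {A : Type*}
  {Ω₂ : Set A} {t₀ t₁ : ℝ} {a : Fin m → Fin m → ℝ → ℝ} {b : Fin m → ℝ → ℝ} {c : ℝ → ℝ}
  {ω : (Fin m → ℝ) × A → ℝ → ℝ} {φ : (Fin m → ℝ) × A → ℝ} {V : (Fin m → ℝ) × A → ℝ → ℝ}

theorem IsClassicalSolution.convexOn [AddCommGroup A] [Module ℝ A] (ht : t₀ < t₁)
    (ha : ∀ i j, ContinuousOn (a i j) (Icc t₀ t₁)) (hb : ∀ i, ContinuousOn (b i) (Icc t₀ t₁))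
    (hc : ContinuousOn c (Icc t₀ t₁)) (hell : IsUniformlyElliptic a (Icc t₀ t₁))
    (hω : ∀ z ∈ Ω₂, ContinuousOn (fun p : (Fin m → ℝ) × ℝ => ω (p.1, z) p.2)
      (posOrthant m ×ˢ Icc t₀ t₁))
    (hV : IsClassicalSolution Ω₂ t₀ t₁ a b c ω φ V) (hgrowth : GaussianGrowth Ω₂ t₀ t₁ V)
    (hφ : ConvexOn ℝ (posOrthant m ×ˢ Ω₂) φ)
    (hω' : ∀ t ∈ Ioc t₀ t₁, ConvexOn ℝ (posOrthant m ×ˢ Ω₂) (fun x => ω x t))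
    {t : ℝ} (ht' : t ∈ Ioc t₀ t₁) : ConvexOn ℝ (posOrthant m ×ˢ Ω₂) (fun x => V x t) := by
  refine ⟨hφ.1, ?_⟩
  rintro ⟨x, z⟩ hx ⟨x', z'⟩ hx' θ θ' hθ hθ' hsum
  have hmid : (θ • x + θ' • x', θ • z + θ' • z') ∈ posOrthant m ×ˢ Ω₂ :=
    hφ.1 hx hx' hθ hθ' hsum
  -- Scaling coordinatewise by `exp y` is linear, so it sends the convex combination of `x` and `x'`
  -- to that of their images. The inequality serves both for the source and for the initial value.
  have key : ∀ g : (Fin m → ℝ) × A → ℝ, ConvexOn ℝ (posOrthant m ×ˢ Ω₂) g → ∀ y : Fin m → ℝ,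
      0 ≤ θ * g (expVec (y + logVec x), z) + θ' * g (expVec (y + logVec x'), z')
        + -1 * g (expVec (y + logVec (θ • x + θ' • x')), θ • z + θ' • z') := by
    intro g hg y
    have h := hg.2 (x := (expVec (y + logVec x), z)) ⟨expVec_mem _, hx.2⟩
      (y := (expVec (y + logVec x'), z')) ⟨expVec_mem _, hx'.2⟩ hθ hθ' hsum
    have e : expVec (y + logVec (θ • x + θ' • x')) =
        θ • expVec (y + logVec x) + θ' • expVec (y + logVec x') := by
      rw [expVec_add_logVec hx.1, expVec_add_logVec hx'.1, expVec_add_logVec hmid.1]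
      ext i
      simp only [Pi.add_apply, Pi.smul_apply, smul_eq_mul]; ring
    rw [e]
    simp only [Prod.smul_mk, Prod.mk_add_mk, smul_eq_mul] at h
    linarith
  have hsol := ((((hV.isWeakSol hgrowth hx.2 (hω _ hx.2)).translate (logVec x)).const_mul θ).add
    (((hV.isWeakSol hgrowth hx'.2 (hω _ hx'.2)).translate (logVec x')).const_mul θ')).add
    (((hV.isWeakSol hgrowth hmid.2 (hω _ hmid.2)).translate
      (logVec (θ • x + θ' • x'))).const_mul (-1))
  have h := nonneg_of_isWeakSol_log ha hb hc hell hsol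
    (fun τ hτ y => key _ (hω' (t₁ - τ) ⟨by linarith [hτ.2], by linarith [hτ.1]⟩) y)
    (fun y => by
      simp only [logTransform_eq, sub_zero]
      rw [hV.eq_terminal ht (expVec_mem _) hx.2, hV.eq_terminal ht (expVec_mem _) hx'.2,
        hV.eq_terminal ht (expVec_mem (y + logVec (θ • x + θ' • x'))) hmid.2]
      exact key φ hφ y) 0 (t₁ - t) ⟨by linarith [ht'.2], by linarith [ht'.1]⟩
  simp only [logTransform_eq, sub_sub_cancel, zero_add, expVec_logVec hx.1, expVec_logVec hx'.1,
    expVec_logVec hmid.1] at h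
  simp only [Prod.smul_mk, Prod.mk_add_mk, smul_eq_mul] at h ⊢
  linarith

theorem IsClassicalSolution.monotoneOn [PartialOrder A] (ht : t₀ < t₁)
    (ha : ∀ i j, ContinuousOn (a i j) (Icc t₀ t₁)) (hb : ∀ i, ContinuousOn (b i) (Icc t₀ t₁))
    (hc : ContinuousOn c (Icc t₀ t₁)) (hell : IsUniformlyElliptic a (Icc t₀ t₁))
    (hω : ∀ z ∈ Ω₂, ContinuousOn (fun p : (Fin m → ℝ) × ℝ => ω (p.1, z) p.2)
      (posOrthant m ×ˢ Icc t₀ t₁))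
    (hV : IsClassicalSolution Ω₂ t₀ t₁ a b c ω φ V) (hgrowth : GaussianGrowth Ω₂ t₀ t₁ V)
    (hφ : MonotoneOn φ (posOrthant m ×ˢ Ω₂))
    (hω' : ∀ t ∈ Ioc t₀ t₁, MonotoneOn (fun x => ω x t) (posOrthant m ×ˢ Ω₂))
    {t : ℝ} (ht' : t ∈ Ioc t₀ t₁) : MonotoneOn (fun x => V x t) (posOrthant m ×ˢ Ω₂) := by
  rintro ⟨x, z⟩ hx ⟨x', z'⟩ hx' hle
  have key : ∀ g : (Fin m → ℝ) × A → ℝ, MonotoneOn g (posOrthant m ×ˢ Ω₂) → ∀ y : Fin m → ℝ,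
      0 ≤ g (expVec (y + logVec x'), z') + -1 * g (expVec (y + logVec x), z) := by
    intro g hg y
    have h := hg (a := (expVec (y + logVec x), z)) ⟨expVec_mem _, hx.2⟩
      (b := (expVec (y + logVec x'), z')) ⟨expVec_mem _, hx'.2⟩ ⟨?_, hle.2⟩
    · linarith
    · simp only [expVec_add_logVec hx.1, expVec_add_logVec hx'.1]
      exact fun i => mul_le_mul_of_nonneg_left (hle.1 i) (Real.exp_nonneg _)
  have hsol := ((hV.isWeakSol hgrowth hx'.2 (hω _ hx'.2)).translate (logVec x')).add
    (((hV.isWeakSol hgrowth hx.2 (hω _ hx.2)).translate (logVec x)).const_mul (-1))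
  have h := nonneg_of_isWeakSol_log ha hb hc hell hsol
    (fun τ hτ y => key _ (hω' (t₁ - τ) ⟨by linarith [hτ.2], by linarith [hτ.1]⟩) y)
    (fun y => by
      simp only [logTransform_eq, sub_zero]
      rw [hV.eq_terminal ht (expVec_mem _) hx.2, hV.eq_terminal ht (expVec_mem _) hx'.2]
      exact key φ hφ y) 0 (t₁ - t) ⟨by linarith [ht'.2], by linarith [ht'.1]⟩
  simp only [logTransform_eq, sub_sub_cancel, zero_add, expVec_logVec hx.1,
    expVec_logVec hx'.1] at h
  simp only
  linarith

end Preservation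

/-! ### The limit at the initial date -/

/-- A function with integrable derivative near the right end point has a left limit there. -/
theorem exists_tendsto_of_hasDerivAt_of_integrableOn {T : ℝ} (hT : 0 < T) {F F' g : ℝ → ℝ}
    (hF : ∀ τ ∈ Ioo 0 T, HasDerivAt F (F' τ) τ) (hg : IntegrableOn g (Ioo 0 T))
    (hle : ∀ τ ∈ Ioo 0 T, |F' τ| ≤ g τ) : ∃ L, Tendsto F (𝓝[<] T) (𝓝 L) := by
  have hint : IntegrableOn (deriv F) (Ioo 0 T) := by
    refine Integrable.mono' hg (measurable_deriv F).aestronglyMeasurable ?_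
    filter_upwards [ae_restrict_mem measurableSet_Ioo] with τ hτ
    rw [(hF τ hτ).deriv]; exact hle τ hτ
  have hint' : IntegrableOn (deriv F) (uIcc (T / 2) T) := by
    rw [uIcc_of_le (by linarith), integrableOn_Icc_iff_integrableOn_Ioo]
    exact hint.mono_set (Ioo_subset_Ioo_left (by linarith))
  have hc := intervalIntegral.continuousOn_primitive_interval hint' T right_mem_uIcc
  rw [uIcc_of_le (by linarith)] at hc
  have hlim : Tendsto (fun τ => F (T / 2) + ∫ s in (T / 2)..τ, deriv F s) (𝓝[<] T)
      (𝓝 (F (T / 2) + ∫ s in (T / 2)..T, deriv F s)) := by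
    refine (hc.mono_left ?_).const_add _
    rw [← nhdsWithin_Ioo_eq_nhdsLT (show T / 2 < T by linarith)]
    exact nhdsWithin_mono _ Ioo_subset_Icc_self
  refine ⟨_, hlim.congr' ?_⟩
  filter_upwards [Ioo_mem_nhdsLT (show T / 2 < T by linarith)] with τ hτ
  have hsub : uIcc (T / 2) τ ⊆ Ioo 0 T := by
    rw [uIcc_of_le hτ.1.le]
    exact fun s hs => ⟨by linarith [hs.1], hs.2.trans_lt hτ.2⟩
  rw [intervalIntegral.integral_eq_sub_of_hasDerivAt
    (fun s hs => by rw [(hF s (hsub hs)).deriv]; exact hF s (hsub hs))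
    ((hint.mono_set hsub).intervalIntegrable)]
  ring

/-- The time derivative is dominated by a multiple of the mass of `u` on a ball plus a constant.
This is integrable up to `T` by the growth condition, without any pointwise bound on `u` near `T`.
-/
theorem IsWeakSol.exists_tendsto_mollify {m : ℕ} {T : ℝ} (hT : 0 < T)
    {a : Fin m → Fin m → ℝ → ℝ} {β : Fin m → ℝ → ℝ} {γ : ℝ → ℝ} {f u : (Fin m → ℝ) → ℝ → ℝ}
    (h : IsWeakSol T a β γ f u) {M : ℝ}
    (ha : ∀ τ ∈ Ioo 0 T, ∀ i j, |a i j τ| ≤ M) (hβ : ∀ τ ∈ Ioo 0 T, ∀ i, |β i τ| ≤ M)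
    (hγ : ∀ τ ∈ Ioo 0 T, |γ τ| ≤ M) {ζ : (Fin m → ℝ) → ℝ} (hζ : IsTest ζ) (y : Fin m → ℝ)
    {K₀ : ℝ} (hf : ∀ τ ∈ Ioo 0 T, |∫ w, f w τ * ζ (y - w)| ≤ K₀) :
    ∃ L, Tendsto (fun τ => ∫ w, u w τ * ζ (y - w)) (𝓝[<] T) (𝓝 L) := by
  obtain ⟨K, R, hK, hbound⟩ := exists_ellOp_bound hζ M
  obtain ⟨k, C, hk, hC⟩ := h.exists_integral_ball_le R
  refine exists_tendsto_of_hasDerivAt_of_integrableOn hT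
    (fun τ hτ => h.hasDerivAt_mollify hζ y hτ)
    (g := fun s => K * (∫ w in Metric.closedBall y R, |u w s|) + K₀)
    (((hC y).1.const_mul K).add (integrableOn_const (by simp))) fun τ hτ => ?_
  refine (abs_add_le _ _).trans (add_le_add ?_ (hf τ hτ))
  exact abs_integral_mul_le_of_indicator_bound (h.continuous_space (Ioo_subset_Ico_self hτ)) y
    (hbound _ _ _ (ha τ hτ) (hβ τ hτ) (hγ τ hτ))

/-- A family of convex functions on the half-line converges at `1` if it is squeezed, between any
two points, by a convergent function. -/
theorem exists_tendsto_of_convexOn_of_squeeze {l : Filter ℝ} [l.NeBot] {h : ℝ → ℝ → ℝ}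
    (hconv : ∀ᶠ τ in l, ConvexOn ℝ (Ioi 0) fun s => h s τ)
    (hsq : ∀ s₁ s₂ : ℝ, 0 < s₁ → s₁ < s₂ → ∃ (F : ℝ → ℝ) (L : ℝ), Tendsto F l (𝓝 L) ∧
      ∀ᶠ τ in l, h s₁ τ ≤ F τ ∧ F τ ≤ h s₂ τ) :
    ∃ L, Tendsto (h 1) l (𝓝 L) := by
  -- These two pairs bound `h 4` above and `h (1 / 2)` below, eventually in `τ`; the `2` in `B` is
  -- one unit of slack for each limit.
  obtain ⟨Fu, Lu, hFu, hFu'⟩ := hsq 4 5 (by norm_num) (by norm_num)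
  obtain ⟨Fl, Ll, hFl, hFl'⟩ := hsq (1 / 4) (1 / 2) (by norm_num) (by norm_num)
  set B : ℝ := |Lu| + |Ll| + 2 with hB
  have hB0 : 0 < B := by positivity
  have hbd : ∀ᶠ τ in l, h 4 τ - h (1 / 2) τ ≤ B := by
    filter_upwards [hFu', hFl', hFu.eventually (gt_mem_nhds (lt_add_one Lu)),
      hFl.eventually (lt_mem_nhds (sub_one_lt Ll))] with τ h1 h2 h3 h4
    have := le_abs_self Lu
    have := neg_abs_le Ll
    linarith [h1.1, h2.2]
  refine cauchy_map_iff_exists_tendsto.1 (Metric.cauchy_iff.2 ⟨inferInstance, fun η hη => ?_⟩)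
  -- Convexity compares the slope on `[1 - ε, 1 + ε]` with that on `[1 + ε, 4]`, an interval of
  -- length at least `2`; the oscillation is thus at most `ε * B ≤ η / 4`.
  set ε : ℝ := min (1 / 4) (η / (4 * B)) with hε
  have hε0 : 0 < ε := lt_min (by norm_num) (by positivity)
  have hε1 : ε ≤ 1 / 4 := min_le_left _ _
  have hε2 : ε * B ≤ η / 4 := by
    calc ε * B ≤ η / (4 * B) * B := by gcongr; exact min_le_right _ _
      _ = η / 4 := by field_simp
  obtain ⟨F₁, L₁, hF₁, hF₁'⟩ := hsq (1 - ε) 1 (by linarith) (by linarith)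
  obtain ⟨F₂, L₂, hF₂, hF₂'⟩ := hsq 1 (1 + ε) (by norm_num) (by linarith)
  -- Only the comparison `h (1 / 2) ≤ h (1 + ε)` is wanted here, not the limit.
  obtain ⟨F₃, _, -, hF₃'⟩ := hsq (1 / 2) (1 + ε) (by norm_num) (by linarith)
  have hdiff : ∀ᶠ τ in l, F₂ τ - F₁ τ ≤ η / 4 := by
    filter_upwards [hconv, hbd, hF₁', hF₂', hF₃'] with τ hc hb h1 h2 h3
    have hs := hc.slope_mono_adjacent (x := 1 - ε) (y := 1 + ε) (z := 4)
      (show 0 < 1 - ε by linarith) (show (0 : ℝ) < 4 by norm_num) (by linarith) (by linarith)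
    rw [div_le_div_iff₀ (by linarith) (by linarith)] at hs
    have hle : h 4 τ - h (1 + ε) τ ≤ B := by linarith [h3.1, h3.2]
    have h5 : (h (1 + ε) τ - h (1 - ε) τ) * 2 ≤ B * (2 * ε) := by
      have h6 : 0 ≤ h (1 + ε) τ - h (1 - ε) τ := by linarith [h1.1, h1.2, h2.1, h2.2]
      nlinarith
    linarith [h1.1, h2.2]
  have hL : L₂ - L₁ ≤ η / 4 := le_of_tendsto (hF₂.sub hF₁) hdiff
  refine ⟨Icc (L₁ - η / 8) (L₂ + η / 8), ?_, fun x hx y hy => ?_⟩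
  · rw [mem_map]
    filter_upwards [hF₁', hF₂', hF₁.eventually (lt_mem_nhds (show L₁ - η / 8 < L₁ by linarith)),
      hF₂.eventually (gt_mem_nhds (show L₂ < L₂ + η / 8 by linarith))] with τ h1 h2 h3 h4
    exact ⟨h3.le.trans h1.2, h2.1.trans h4.le⟩
  · rw [Real.dist_eq, abs_lt]
    constructor <;> linarith [hx.1, hx.2, hy.1, hy.2]

theorem ContDiffBump.isTest_normed {m : ℕ} (ρ : ContDiffBump (0 : Fin m → ℝ)) :
    IsTest (ρ.normed volume) :=
  ⟨ρ.contDiff_normed, ρ.hasCompactSupport_normed⟩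

theorem ContDiffBump.le_mollify {m : ℕ} (ρ : ContDiffBump (0 : Fin m → ℝ))
    {g : (Fin m → ℝ) → ℝ} (hg : Continuous g) {y : Fin m → ℝ} {c : ℝ}
    (hle : ∀ w, dist w y < ρ.rOut → c ≤ g w) : c ≤ ∫ w, g w * ρ.normed volume (y - w) := by
  have hi : ∫ w, ρ.normed volume (y - w) = 1 := by
    rw [integral_sub_left_eq_self (ρ.normed volume) volume y, ρ.integral_normed]
  have hζ := ρ.isTest_normed.comp_sub_left y
  calc c = ∫ w, c * ρ.normed volume (y - w) := by rw [integral_const_mul, hi, mul_one]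
    _ ≤ ∫ w, g w * ρ.normed volume (y - w) := by
      refine integral_mono (hζ.integrable_mul continuous_const) (hζ.integrable_mul hg) fun w => ?_
      by_cases hw : dist w y < ρ.rOut
      · exact mul_le_mul_of_nonneg_right (hle w hw) (ρ.nonneg_normed _)
      · have h0 : ρ.normed volume (y - w) = 0 := by
          rw [← Function.notMem_support, ρ.support_normed_eq]
          simpa [dist_eq_norm, norm_sub_rev] using hw
        simp [h0]

theorem ContDiffBump.mollify_le {m : ℕ} (ρ : ContDiffBump (0 : Fin m → ℝ))
    {g : (Fin m → ℝ) → ℝ} (hg : Continuous g) {y : Fin m → ℝ} {c : ℝ}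
    (hle : ∀ w, dist w y < ρ.rOut → g w ≤ c) : ∫ w, g w * ρ.normed volume (y - w) ≤ c := by
  have := ρ.le_mollify (g := fun w => -g w) hg.neg (y := y) (c := -c) fun w hw => neg_le_neg (hle w hw)
  simp only [neg_mul, integral_neg] at this
  linarith

/-- Weak solutions in logarithmic coordinates have limits, after mollification, at the end of the
time interval if the source is continuous up to there. -/
theorem exists_tendsto_mollify_log {m : ℕ} {t₀ t₁ : ℝ} (ht : t₀ < t₁)
    {a : Fin m → Fin m → ℝ → ℝ} {b : Fin m → ℝ → ℝ} {c : ℝ → ℝ}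
    (ha : ∀ i j, ContinuousOn (a i j) (Icc t₀ t₁)) (hb : ∀ i, ContinuousOn (b i) (Icc t₀ t₁))
    (hc : ContinuousOn c (Icc t₀ t₁)) {g : (Fin m → ℝ) → ℝ → ℝ}
    (hg : ContinuousOn (fun p : (Fin m → ℝ) × ℝ => g p.1 p.2) (posOrthant m ×ˢ Icc t₀ t₁))
    {u : (Fin m → ℝ) → ℝ → ℝ}
    (h : IsWeakSol (t₁ - t₀) (fun i j τ => a i j (t₁ - τ))
      (fun i τ => b i (t₁ - τ) - 1 / 2 * a i i (t₁ - τ)) (fun τ => c (t₁ - τ))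
      (fun y τ => g (expVec y) (t₁ - τ)) u)
    {ζ : (Fin m → ℝ) → ℝ} (hζ : IsTest ζ) (y : Fin m → ℝ) :
    ∃ L, Tendsto (fun τ => ∫ w, u w τ * ζ (y - w)) (𝓝[<] (t₁ - t₀)) (𝓝 L) := by
  obtain ⟨M₂, hM₂, h₂⟩ := exists_bound_of_continuousOn_Icc
    (h := fun (p : Fin m × Fin m) t => a p.1 p.2 t) fun p => ha p.1 p.2
  obtain ⟨M₁, hM₁, h₁⟩ := exists_bound_of_continuousOn_Icc
    (h := fun i t => b i t - 1 / 2 * a i i t)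
    fun i => (hb i).sub (continuousOn_const.mul (ha i i))
  obtain ⟨M₀, hM₀, h₀⟩ := exists_bound_of_continuousOn_Icc (ι := Unit) (h := fun _ => c)
    fun _ => hc
  have hI : ∀ τ ∈ Ioo 0 (t₁ - t₀), t₁ - τ ∈ Icc t₀ t₁ := fun τ hτ =>
    ⟨by linarith [hτ.2], by linarith [hτ.1]⟩
  have hζ' := hζ.comp_sub_left y
  have hcont : ContinuousOn (fun t => ∫ w, g (expVec w) t * ζ (y - w)) (Icc t₀ t₁) := by
    refine continuousOn_integral_of_compact_support
      (f := fun (t : ℝ) w => g (expVec w) t * ζ (y - w)) hζ'.compact ?_ fun t w _ hw => by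
        simp [image_eq_zero_of_notMem_tsupport hw]
    refine ContinuousOn.mul ?_ (hζ'.continuous.comp continuous_snd).continuousOn
    exact hg.comp (f := fun q : ℝ × (Fin m → ℝ) => (expVec q.2, q.1))
      ((continuous_expVec.comp continuous_snd).prodMk continuous_fst).continuousOn
      fun q hq => ⟨expVec_mem _, hq.1⟩
  obtain ⟨K₀, hK₀⟩ := isCompact_Icc.exists_bound_of_continuousOn hcont
  exact h.exists_tendsto_mollify (sub_pos.2 ht) (M := M₂ + M₁ + M₀)
    (fun τ hτ i j => (h₂ (i, j) _ (hI τ hτ)).trans (by linarith))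
    (fun τ hτ i => (h₁ i _ (hI τ hτ)).trans (by linarith))
    (fun τ hτ => (h₀ () _ (hI τ hτ)).trans (by linarith)) hζ y
    (fun τ hτ => hK₀ (t₁ - τ) (hI τ hτ))

/-- The ray `s ↦ s • x` reduces the question to one variable: a mollification in logarithmic
coordinates centred between `s₁ • x` and `s₂ • x` averages values of `V` at points lying between
these two in the order. -/
theorem IsClassicalSolution.exists_tendsto {m : ℕ} {A : Type*} {Ω₂ : Set A} {t₀ t₁ : ℝ}
    (ht : t₀ < t₁) {a : Fin m → Fin m → ℝ → ℝ} {b : Fin m → ℝ → ℝ} {c : ℝ → ℝ}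
    {ω : (Fin m → ℝ) × A → ℝ → ℝ} {φ : (Fin m → ℝ) × A → ℝ} {V : (Fin m → ℝ) × A → ℝ → ℝ}
    (ha : ∀ i j, ContinuousOn (a i j) (Icc t₀ t₁)) (hb : ∀ i, ContinuousOn (b i) (Icc t₀ t₁))
    (hc : ContinuousOn c (Icc t₀ t₁))
    (hω : ∀ z ∈ Ω₂, ContinuousOn (fun p : (Fin m → ℝ) × ℝ => ω (p.1, z) p.2)
      (posOrthant m ×ˢ Icc t₀ t₁))
    (hV : IsClassicalSolution Ω₂ t₀ t₁ a b c ω φ V) (hgrowth : GaussianGrowth Ω₂ t₀ t₁ V)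
    {z : A} (hz : z ∈ Ω₂)
    (hconv : ∀ t ∈ Ioc t₀ t₁, ConvexOn ℝ (posOrthant m) fun x => V (x, z) t)
    (hmono : ∀ t ∈ Ioc t₀ t₁, MonotoneOn (fun x => V (x, z) t) (posOrthant m))
    {x : Fin m → ℝ} (hx : x ∈ posOrthant m) :
    ∃ L, Tendsto (fun t => V (x, z) t) (𝓝[>] t₀) (𝓝 L) := by
  have hw := hV.isWeakSol hgrowth hz (hω z hz)
  have hev : ∀ᶠ τ in 𝓝[<] (t₁ - t₀), τ ∈ Ioo 0 (t₁ - t₀) := Ioo_mem_nhdsLT (sub_pos.2 ht)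
  have hI : ∀ τ ∈ Ioo 0 (t₁ - t₀), t₁ - τ ∈ Ioc t₀ t₁ := fun τ hτ =>
    ⟨by linarith [hτ.2], by linarith [hτ.1]⟩
  have hpos : ∀ s : ℝ, 0 < s → s • x ∈ posOrthant m := fun s hs i => mul_pos hs (hx i)
  obtain ⟨L, hL⟩ := exists_tendsto_of_convexOn_of_squeeze (l := 𝓝[<] (t₁ - t₀))
    (h := fun s τ => V (s • x, z) (t₁ - τ)) (by
      filter_upwards [hev] with τ hτ
      refine ⟨convex_Ioi 0, fun s hs s' hs' p q hp hq hpq => ?_⟩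
      have := (hconv _ (hI τ hτ)).2 (hpos s hs) (hpos s' hs') hp hq hpq
      simpa only [smul_smul, ← add_smul, smul_eq_mul] using this) (by
      intro s₁ s₂ hs₁ hs₂
      have hs₂' := hs₁.trans hs₂
      have hlog : Real.log s₁ < Real.log s₂ := Real.log_lt_log hs₁ hs₂
      -- Half the logarithmic gap as radius, with `y` the midpoint, keeps the support of the bump
      -- inside the box from `s₁ • x` to `s₂ • x`.
      set ε : ℝ := (Real.log s₂ - Real.log s₁) / 2 with hε
      have hε0 : 0 < ε := by simp only [hε]; linarith
      let ρ : ContDiffBump (0 : Fin m → ℝ) := ⟨ε / 2, ε, by positivity, by linarith⟩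
      set y : Fin m → ℝ := fun i => Real.log s₁ + ε + Real.log (x i) with hy
      obtain ⟨L, hL⟩ := exists_tendsto_mollify_log (g := fun x t => ω (x, z) t) ht ha hb hc
        (hω z hz) hw ρ.isTest_normed y
      refine ⟨_, L, hL, ?_⟩
      filter_upwards [hev] with τ hτ
      have hcs := hw.continuous_space (Ioo_subset_Ico_self hτ)
      have hdist : ∀ w : Fin m → ℝ, dist w y < ρ.rOut → ∀ i,
          Real.log s₁ + Real.log (x i) ≤ w i ∧ w i ≤ Real.log s₂ + Real.log (x i) := by
        intro w hw' i
        have h1 : |w i - y i| < ε := (dist_le_pi_dist w y i).trans_lt hw'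
        have h2 := abs_lt.1 h1
        simp only [hy] at h2
        constructor <;> linarith [h2.1, h2.2]
      have hexp : ∀ s : ℝ, 0 < s → ∀ i, Real.exp (Real.log s + Real.log (x i)) = s * x i :=
        fun s hs i => by rw [Real.exp_add, Real.exp_log hs, Real.exp_log (hx i)]
      constructor
      · refine ρ.le_mollify hcs fun w hw' => ?_
        refine hmono _ (hI τ hτ) (hpos s₁ hs₁) (expVec_mem w) fun i => ?_
        rw [Pi.smul_apply, smul_eq_mul, ← hexp s₁ hs₁]
        exact Real.exp_le_exp.2 (hdist w hw' i).1
      · refine ρ.mollify_le hcs fun w hw' => ?_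
        refine hmono _ (hI τ hτ) (expVec_mem w) (hpos s₂ hs₂') fun i => ?_
        rw [Pi.smul_apply, smul_eq_mul, ← hexp s₂ hs₂']
        exact Real.exp_le_exp.2 (hdist w hw' i).2)
  refine ⟨L, ?_⟩
  have hrev : Tendsto (fun t => t₁ - t) (𝓝[>] t₀) (𝓝[<] (t₁ - t₀)) := by
    refine tendsto_nhdsWithin_iff.2 ⟨?_, ?_⟩
    · exact ((continuous_const.sub continuous_id).tendsto t₀).mono_left nhdsWithin_le_nhds
    · filter_upwards [self_mem_nhdsWithin] with t ht'
      exact sub_lt_sub_left ht' t₁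
  simpa [Function.comp_def] using hL.comp hrev

theorem mainTheorem4 {m : ℕ} {A : Type*} [AddCommGroup A] [Module ℝ A] [PartialOrder A]
    (Ω₂ : Set A) (hΩ₂ : Convex ℝ Ω₂)
    (t₀ t₁ : ℝ) (ht : t₀ < t₁)
    (a : Fin m → Fin m → ℝ → ℝ) (b : Fin m → ℝ → ℝ) (c : ℝ → ℝ)
    (ω : (Fin m → ℝ) × A → ℝ → ℝ) (φ : (Fin m → ℝ) × A → ℝ)
    (V : (Fin m → ℝ) × A → ℝ → ℝ)
    (ha : ∀ i j, ContinuousOn (a i j) (Icc t₀ t₁))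
    (hb : ∀ i, ContinuousOn (b i) (Icc t₀ t₁))
    (hc : ContinuousOn c (Icc t₀ t₁))
    (hell : IsUniformlyElliptic a (Icc t₀ t₁))
    (hω : ∀ z ∈ Ω₂, ContinuousOn (fun p : (Fin m → ℝ) × ℝ => ω (p.1, z) p.2)
      (posOrthant m ×ˢ Icc t₀ t₁))
    (hV : IsClassicalSolution Ω₂ t₀ t₁ a b c ω φ V)
    (hgrowth : GaussianGrowth Ω₂ t₀ t₁ V)
    (hφ_conv : ConvexOn ℝ (posOrthant m ×ˢ Ω₂) φ)
    (hφ_mono : MonotoneOn φ (posOrthant m ×ˢ Ω₂))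
    (hω_conv : ∀ t ∈ Ioc t₀ t₁, ConvexOn ℝ (posOrthant m ×ˢ Ω₂) (fun x => ω x t))
    (hω_mono : ∀ t ∈ Ioc t₀ t₁, MonotoneOn (fun x => ω x t) (posOrthant m ×ˢ Ω₂)) :
    (∀ t ∈ Ioc t₀ t₁,
      ConvexOn ℝ (posOrthant m ×ˢ Ω₂) (fun x => V x t) ∧
      MonotoneOn (fun x => V x t) (posOrthant m ×ˢ Ω₂)) ∧
    ∃ Vplus : (Fin m → ℝ) × A → ℝ,
      (∀ x ∈ posOrthant m ×ˢ Ω₂, Tendsto (fun t => V x t) (𝓝[>] t₀) (𝓝 (Vplus x))) ∧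
      ConvexOn ℝ (posOrthant m ×ˢ Ω₂) Vplus ∧
      MonotoneOn Vplus (posOrthant m ×ˢ Ω₂) := by
  have hconv : ∀ t ∈ Ioc t₀ t₁, ConvexOn ℝ (posOrthant m ×ˢ Ω₂) (fun x => V x t) := fun t ht' =>
    hV.convexOn ht ha hb hc hell hω hgrowth hφ_conv hω_conv ht'
  have hmono : ∀ t ∈ Ioc t₀ t₁, MonotoneOn (fun x => V x t) (posOrthant m ×ˢ Ω₂) := fun t ht' =>
    hV.monotoneOn ht ha hb hc hell hω hgrowth hφ_mono hω_mono ht'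
  refine ⟨fun t ht' => ⟨hconv t ht', hmono t ht'⟩, ?_⟩
  have hortho : Convex ℝ (posOrthant m) := fun x hx y hy p q hp hq hpq i => by
    have h1 := hx i
    have h2 := hy i
    exact convex_Ioi (0 : ℝ) h1 h2 hp hq hpq
  -- Membership is placed under the existential so that `choose` yields a function on the whole
  -- space, with the irrelevant value `0` off the domain.
  have hlim : ∀ x : (Fin m → ℝ) × A, ∃ L, x ∈ posOrthant m ×ˢ Ω₂ →
      Tendsto (fun t => V x t) (𝓝[>] t₀) (𝓝 L) := by
    rintro ⟨x, z⟩
    by_cases hx : (x, z) ∈ posOrthant m ×ˢ Ω₂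
    · obtain ⟨L, hL⟩ := hV.exists_tendsto ht ha hb hc hω hgrowth hx.2 (fun t ht' => by
        refine ⟨hortho, fun y hy y' hy' p q hp hq hpq => ?_⟩
        have h := (hconv t ht').2 (x := (y, z)) ⟨hy, hx.2⟩ (y := (y', z)) ⟨hy', hx.2⟩ hp hq hpq
        simpa only [Prod.smul_mk, Prod.mk_add_mk, ← add_smul, hpq, one_smul] using h)
        (fun t ht' y hy y' hy' hle =>
          hmono t ht' (a := (y, z)) ⟨hy, hx.2⟩ (b := (y', z)) ⟨hy', hx.2⟩ ⟨hle, le_rfl⟩) hx.1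
      exact ⟨L, fun _ => hL⟩
    · exact ⟨0, fun h => absurd h hx⟩
  choose Vplus hVplus using hlim
  have hev : ∀ᶠ t in 𝓝[>] t₀, t ∈ Ioc t₀ t₁ := Ioc_mem_nhdsGT ht
  refine ⟨Vplus, hVplus, ⟨hortho.prod hΩ₂, fun x hx y hy p q hp hq hpq => ?_⟩,
    fun x hx y hy hle => ?_⟩
  · refine le_of_tendsto_of_tendsto (hVplus _ ((hortho.prod hΩ₂) hx hy hp hq hpq))
      (((hVplus x hx).const_smul p).add ((hVplus y hy).const_smul q)) ?_
    filter_upwards [hev] with t ht' using (hconv t ht').2 hx hy hp hq hpq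
  · refine le_of_tendsto_of_tendsto (hVplus x hx) (hVplus y hy) ?_
    filter_upwards [hev] with t ht' using hmono t ht' hx hy hle
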